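/- Let $d=2^n$ with $n\ge 1$, and let $w(a)$, $a=1,\dots,d^2$, be the $n$-qubit Pauli matrices, i.e. the tensor products of $n$ factors from $\{\mathbb 1,\sigma^x,\sigma^y,\sigma^z\}$. A state is a positive semidefinite complex $d\times d$ matrix of trace $1$; $\|\cdot\|_2$ is the Frobenius norm and $\|\cdot\|_{\mathrm{tr}}$ the trace norm (sum of the singular values). For distinct labels $A_1,\dots,A_m$ put $$\mathcal R X=\frac dm\sum_{i=1}^m \operatorname{tr}\bigl(X\,w(A_i)\bigr)\,w(A_i).$$ There are universal constants $K,B,b>0$ such that the following holds for all $n\ge1$, $r\ge1$, $c>0$ and every integer $m$ with $m=c\,d\,r\,(\log d)^2$ and $m\le d^2$. Let $\rho_t$ be a state and suppose that $\|\rho_t-\rho\|_2\le\varepsilon_1$ for some state $\rho$ of rank at most $r$. Let $\varepsilon_2\ge0$, $\lambda\ge1$ and $$\varepsilon\ \ge\ \lambda\sqrt{d^2/m}\;\varepsilon_1+\varepsilon_2 .$$ Draw $A_1,\dots,A_m$ uniformly at random without replacement. Then, with probability of failure at most $$\frac1{\lambda^2}+B\,e^{-bc},$$ the following is true: for every matrix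 $\omega$ with $\|\mathcal R\omega-\mathcal R\rho_t\|_2\le\varepsilon_2$ ($\omega$ may depend on the draw), every solution $\sigma^\star$ of $$\min\ \|\sigma\|_{\mathrm{tr}}\quad\text{subject to}\quad \|\mathcal R\sigma-\mathcal R\omega\|_2\le\varepsilon$$ satisfies $$\|\sigma^\star-\rho_t\|_{\mathrm{tr}}\ \le\ K\,\varepsilon\sqrt{rd}.$$ This holds whether the minimum is taken over all complex $d\times d$ matrices $\sigma$ or over the Hermitian ones only. (The term $B\,e^{-bc}$ is the bound, exponentially small in $c$, on the probability that noiseless recovery of a rank-$r$ state by trace-norm minimisation from the same number of random Pauli expectations fails.) -/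

import Mathlib

open scoped Matrix ComplexOrder

namespace QTomography

/-- Complex `d × d` matrices with `d = 2 ^ n`, acting on `n` qubits.  The rows and columns are
indexed by the computational basis `Fin n → Fin 2`. -/
abbrev QMat (n : ℕ) : Type := Matrix (Fin n → Fin 2) (Fin n → Fin 2) ℂ

/-- The four single-qubit Pauli matrices `1, σˣ, σʸ, σᶻ`. -/
noncomputable def pauli : Fin 4 → Matrix (Fin 2) (Fin 2) ℂ :=
  ![1, !![0, 1; 1, 0], !![0, -Complex.I; Complex.I, 0], !![1, 0; 0, -1]]

/-- The labels of the `4 ^ n = d ^ 2` Pauli matrices on `n` qubits. -/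
abbrev PauliLabel (n : ℕ) : Type := Fin n → Fin 4

/-- The `n`-qubit Pauli matrix `w(a) = w_1 ⊗ ⋯ ⊗ w_n`, through the entries of the
tensor product. -/
noncomputable def pauliString {n : ℕ} (a : PauliLabel n) : QMat n :=
  Matrix.of fun i j => ∏ k, pauli (a k) (i k) (j k)

/-- The Frobenius norm `‖X‖₂`. -/
noncomputable def frobeniusNorm {n : ℕ} (X : QMat n) : ℝ :=
  Real.sqrt (∑ i, ∑ j, ‖X i j‖ ^ 2)

/-- The trace norm `‖X‖_tr`: the sum of the singular values of `X`, that is, of the square roots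
of the eigenvalues of `Xᴴ X` counted with multiplicity. -/
noncomputable def traceNorm {n : ℕ} (X : QMat n) : ℝ :=
  ∑ i, Real.sqrt ((Matrix.isHermitian_conjTranspose_mul_self X).eigenvalues i)

/-- Quantum states (density matrices): positive semidefinite with unit trace. -/
def IsState {n : ℕ} (ρ : QMat n) : Prop :=
  ρ.PosSemidef ∧ ρ.trace = 1

/-- The sampling operator `ℛ X = (d / m) ∑_{i=1}^m tr (X w(A_i)) w(A_i)`. -/
noncomputable def sampling {n m : ℕ} (A : Fin m → PauliLabel n) (X : QMat n) : QMat n :=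
  ((2 : ℂ) ^ n / (m : ℂ)) •
    ∑ i, (X * pauliString (A i)).trace • pauliString (A i)

/-- Feasibility for the noisy convex program: `‖ℛ σ - ℛ ω‖₂ ≤ ε`. -/
def IsFeasible {n m : ℕ} (A : Fin m → PauliLabel n) (ω : QMat n) (ε : ℝ) (σ : QMat n) : Prop :=
  frobeniusNorm (sampling A σ - sampling A ω) ≤ ε

/-- `σ` solves: minimise `‖σ‖_tr` over `σ ∈ S` subject to `‖ℛ σ - ℛ ω‖₂ ≤ ε`. -/
def IsSolution {n m : ℕ} (S : Set (QMat n)) (A : Fin m → PauliLabel n) (ω : QMat n) (ε : ℝ)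
    (σ : QMat n) : Prop :=
  (σ ∈ S ∧ IsFeasible A ω ε σ) ∧
    ∀ τ ∈ S, IsFeasible A ω ε τ → traceNorm σ ≤ traceNorm τ

/-- The probability of the event `P` when `m` Pauli labels `A_1, …, A_m` are drawn uniformly at
random without replacement, that is, when `A` is a uniformly random injective map.  (It is a
genuine probability when `m ≤ d ^ 2`, so that injective maps exist.) -/
noncomputable def drawProb (n m : ℕ) (P : (Fin m ↪ PauliLabel n) → Prop) : ℝ :=
  (Nat.card {A : Fin m ↪ PauliLabel n // P A} : ℝ) / (Nat.card (Fin m ↪ PauliLabel n) : ℝ)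

end QTomography

/-!
The error bound is a consequence of two properties of the draw `A_1, …, A_m`. Let `P` be the
projection onto the range of `ρ` and call `X` tangential if `(1 - P) X (1 - P) = 0`, and normal if
`(1 - P) X (1 - P) = X`.

* `IsWellConditioned`: the sampled coefficients of every tangential matrix carry at least half of
  the mass that they carry on average.
* `HasCertificate`: the sampled Pauli matrices span a matrix `P - V + S` with `V` tangential and
  small in Frobenius norm, and `S` normal of operator norm at most `1 / 2`.

Given both, write `Δ = σ - ρ` for a feasible `σ` whose trace norm is at most that of `ρ`. The
duality of the trace norm and the operator norm gives `Re tr (P Δ) + ‖N‖_tr ≤ 0` for the normal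
part `N` of `Δ` (`trace_re_add_traceNorm_conj_le`). Rewriting `P` as the certificate plus `V` minus
`S`, the certificate only sees the sampled part of `Δ`, which is small by feasibility, and `S` takes
up at most half of `‖N‖_tr`; the term with `V` is controlled by the tangential part of `Δ`, which
by well-conditioning is controlled by the sampled part of `Δ` and by `N` again. Solving the two
inequalities bounds both parts of `Δ` (`traceNorm_sub_le_of_hasCertificate`). That `ρ` is feasible
holds as soon as the sampled part of `ρt - ρ` is at most `λ √(d² / m) ε₁`, which Markov's inequality
ensures except with probability `1 / λ²` (`drawProb_not_sampling_le`).

Well-conditioning is a matrix Chernoff bound for the rank-one forms `Z ↦ |tr (Z w_a)|²` on the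
tangential matrices (`uniformProb_exists_quadratic_lt_le`). It rests on the Golden–Thompson
inequality, here obtained from the Lie product formula, and on Hoeffding's comparison, by which
sampling without replacement does not increase the mean of a convex function of the sum.

The certificate is produced by a randomised Kaczmarz iteration rather than by the usual golfing
scheme in batches. Starting from the residual `V = P` and `S = 0`, each draw `a` subtracts from `V`
the tangential part of `κ tr (V w_a) w_a` and adds the normal part to `S`, so that `S - V + P` stays
in the span of the draws. A Pauli matrix has squared tangential norm at most `2 r`, so that for
`2 r κ ≤ 1` each step lowers the energy `‖V‖₂²` by at least `κ (tr V w_a)²`, whatever the draw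
(`frobSq_kaczmarzStep_le`). This has two uses. On average the energy decays geometrically, and so
does a high power of it, which makes the residual small with exponentially small failure
probability. Moreover the energy bounds the quadratic variation of the matrix martingale `S`
deterministically, so that `exp (θ² κ ‖V‖₂²) tr exp (θ S)` is a supermartingale
(`sum_potential_kaczmarzStep_le`) and `S` remains small in operator norm. The iteration is run with
independent draws; having a certificate is monotone in the set of sampled labels, and a sample
without replacement can be coupled so as to contain one with replacement
(`uniformProb_embedding_le_uniformProb_fun`).
-/

/-! ### The Frobenius form and the Golden–Thompson inequality -/

namespace QTomography

section GoldenThompson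

open scoped Matrix.Norms.L2Operator MatrixOrder
open Filter Topology

variable {D : Type*} [Fintype D]

/-- The squared Frobenius norm of a complex matrix. -/
noncomputable def frobSq (X : Matrix D D ℂ) : ℝ := ∑ i, ∑ j, ‖X i j‖ ^ 2

lemma frobSq_nonneg (X : Matrix D D ℂ) : 0 ≤ frobSq X := by
  unfold frobSq; positivity

lemma trace_mul_conjTranspose_re (X : Matrix D D ℂ) : (X * Xᴴ).trace.re = frobSq X := by
  simp [Matrix.trace, Matrix.mul_apply, frobSq, Complex.mul_conj, Complex.normSq_eq_norm_sq,
    -Complex.ofReal_pow]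

lemma trace_conjTranspose_mul_re (X : Matrix D D ℂ) : (Xᴴ * X).trace.re = frobSq X := by
  rw [Matrix.trace_mul_comm, trace_mul_conjTranspose_re]

lemma frobSq_conjTranspose (X : Matrix D D ℂ) : frobSq Xᴴ = frobSq X := by
  rw [← trace_mul_conjTranspose_re, Matrix.conjTranspose_conjTranspose, trace_conjTranspose_mul_re]

lemma frobSq_neg (X : Matrix D D ℂ) : frobSq (-X) = frobSq X := by simp [frobSq]

/-- The Cauchy–Schwarz inequality for the Frobenius inner product. -/
lemma norm_trace_mul_sq_le (A B : Matrix D D ℂ) :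
    ‖(A * B).trace‖ ^ 2 ≤ frobSq A * frobSq B := by
  have h1 : ‖(A * B).trace‖ ≤ ∑ p : D × D, ‖A p.1 p.2‖ * ‖B p.2 p.1‖ := by
    simp only [Matrix.trace, Matrix.diag, Matrix.mul_apply, Fintype.sum_prod_type]
    refine (norm_sum_le _ _).trans (Finset.sum_le_sum fun i _ => ?_)
    refine (norm_sum_le _ _).trans (Finset.sum_le_sum fun j _ => ?_)
    rw [norm_mul]
  have h2 := Finset.sum_mul_sq_le_sq_mul_sq (Finset.univ : Finset (D × D))
    (fun p => ‖A p.1 p.2‖) (fun p => ‖B p.2 p.1‖)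
  have hA : ∑ p : D × D, ‖A p.1 p.2‖ ^ 2 = frobSq A := by
    rw [Fintype.sum_prod_type]; rfl
  have hB : ∑ p : D × D, ‖B p.2 p.1‖ ^ 2 = frobSq B := by
    rw [Fintype.sum_prod_type, Finset.sum_comm]; rfl
  rw [hA, hB] at h2
  exact (pow_le_pow_left₀ (norm_nonneg _) h1 2).trans h2

lemma norm_trace_mul_le (A B : Matrix D D ℂ) :
    ‖(A * B).trace‖ ≤ √(frobSq A) * √(frobSq B) := by
  rw [← Real.sqrt_mul (frobSq_nonneg A)]
  exact Real.le_sqrt_of_sq_le (norm_trace_mul_sq_le A B)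

variable [DecidableEq D]

lemma trace_mul_pow_comm (A B : Matrix D D ℂ) (k : ℕ) :
    ((A * B) ^ k).trace = ((B * A) ^ k).trace := by
  cases k with
  | zero => simp
  | succ k =>
    have h : SemiconjBy A (B * A) (A * B) := by simp [SemiconjBy, mul_assoc]
    have h' := (h.pow_right k).eq
    rw [pow_succ, ← mul_assoc, ← h', mul_assoc, Matrix.trace_mul_comm, pow_succ, mul_assoc]

lemma trace_mul_nonneg {P Q : Matrix D D ℂ} (hP : P.PosSemidef) (hQ : Q.PosSemidef) :
    0 ≤ (P * Q).trace := by
  obtain ⟨B, rfl⟩ := CStarAlgebra.nonneg_iff_eq_star_mul_self.mp hP.nonneg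
  rw [mul_assoc, Matrix.trace_mul_comm]
  exact (hQ.mul_mul_conjTranspose_same B).trace_nonneg

/-- For a power of two, `|tr M ^ (2 p)| ≤ tr (M Mᴴ) ^ p`, and
`|tr (P Q) ^ p| ≤ tr (P ^ p Q ^ p)` for positive semidefinite `P`, `Q`.  Each of the two families
of inequalities is needed in the inductive step of the other. -/
lemma norm_trace_pow_two_pow_le (k : ℕ) :
    (∀ M : Matrix D D ℂ, ‖(M ^ 2 ^ (k + 1)).trace‖ ≤ ((M * Mᴴ) ^ 2 ^ k).trace.re) ∧
    (∀ P Q : Matrix D D ℂ, P.PosSemidef → Q.PosSemidef →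
      ‖((P * Q) ^ 2 ^ k).trace‖ ≤ (P ^ 2 ^ k * Q ^ 2 ^ k).trace.re) := by
  induction k with
  | zero =>
    refine ⟨fun M => ?_, fun P Q hP hQ => ?_⟩
    · have h := norm_trace_mul_le M M
      rw [Real.mul_self_sqrt (frobSq_nonneg M)] at h
      simpa [pow_succ, trace_mul_conjTranspose_re] using h
    · have h := trace_mul_nonneg hP hQ
      simp only [pow_zero, pow_one]
      rw [Complex.le_def] at h
      rw [← Complex.re_eq_norm.2 (Complex.le_def.2 h)]
  | succ k ih =>
    obtain ⟨ihH, ihG⟩ := ih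
    refine ⟨fun M => ?_, fun P Q hP hQ => ?_⟩
    · have h1 := ihH (M ^ 2)
      rw [← pow_mul, ← pow_succ'] at h1
      have e1 : M ^ 2 * (M ^ 2)ᴴ = M * (M * Mᴴ * Mᴴ) := by
        rw [Matrix.conjTranspose_pow]; simp [pow_two, mul_assoc]
      have e2 : M * Mᴴ * Mᴴ * M = (M * Mᴴ) * (Mᴴ * M) := by simp [mul_assoc]
      rw [e1, trace_mul_pow_comm, e2] at h1
      have h2 := ihG (M * Mᴴ) (Mᴴ * M) (Matrix.posSemidef_self_mul_conjTranspose M)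
        (Matrix.posSemidef_conjTranspose_mul_self M)
      have h3 := norm_trace_mul_le ((M * Mᴴ) ^ 2 ^ k) ((Mᴴ * M) ^ 2 ^ k)
      have f1 : frobSq ((M * Mᴴ) ^ 2 ^ k) = ((M * Mᴴ) ^ 2 ^ (k + 1)).trace.re := by
        rw [← trace_mul_conjTranspose_re, Matrix.conjTranspose_pow,
          (Matrix.isHermitian_mul_conjTranspose_self M).eq, ← pow_add, ← two_mul, ← pow_succ']
      have f2 : frobSq ((Mᴴ * M) ^ 2 ^ k) = ((M * Mᴴ) ^ 2 ^ (k + 1)).trace.re := by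
        rw [← trace_mul_conjTranspose_re, Matrix.conjTranspose_pow,
          (Matrix.isHermitian_conjTranspose_mul_self M).eq, ← pow_add, ← two_mul, ← pow_succ',
          trace_mul_pow_comm]
      rw [f1, f2, Real.mul_self_sqrt (f1 ▸ frobSq_nonneg _)] at h3
      exact h1.trans ((Complex.re_le_norm _).trans (h2.trans ((Complex.re_le_norm _).trans h3)))
    · have h1 := ihH (P * Q)
      have e1 : P * Q * (P * Q)ᴴ = P * (Q ^ 2 * P) := by
        rw [Matrix.conjTranspose_mul, hP.1.eq, hQ.1.eq]; simp [pow_two, mul_assoc]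
      have e2 : Q ^ 2 * P * P = Q ^ 2 * P ^ 2 := by simp [pow_two, mul_assoc]
      rw [e1, trace_mul_pow_comm P (Q ^ 2 * P), e2, trace_mul_pow_comm (Q ^ 2)] at h1
      have h2 := ihG (P ^ 2) (Q ^ 2) (hP.pow 2) (hQ.pow 2)
      rw [← pow_mul, ← pow_mul, ← pow_succ'] at h2
      exact h1.trans ((Complex.re_le_norm _).trans h2)

lemma norm_pow_sub_pow_le {R : Type*} [NormedRing R] [NormOneClass R] {x y : R} {c : ℝ}
    (hx : ‖x‖ ≤ c) (hy : ‖y‖ ≤ c) (N : ℕ) :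
    ‖x ^ N - y ^ N‖ ≤ N * c ^ (N - 1) * ‖x - y‖ := by
  have hc : 0 ≤ c := (norm_nonneg x).trans hx
  induction N with
  | zero => simp
  | succ N ih =>
    have e : x ^ (N + 1) - y ^ (N + 1) = x ^ N * (x - y) + (x ^ N - y ^ N) * y := by
      rw [pow_succ, pow_succ]; noncomm_ring
    have h1 : ‖x ^ N * (x - y)‖ ≤ c ^ N * ‖x - y‖ :=
      (norm_mul_le _ _).trans (by
        gcongr; exact (norm_pow_le x N).trans (pow_le_pow_left₀ (norm_nonneg _) hx N))
    have h2 : ‖(x ^ N - y ^ N) * y‖ ≤ N * c ^ N * ‖x - y‖ := by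
      refine (norm_mul_le _ _).trans ?_
      calc ‖x ^ N - y ^ N‖ * ‖y‖ ≤ (N * c ^ (N - 1) * ‖x - y‖) * c := by gcongr
        _ = N * (c ^ (N - 1) * c) * ‖x - y‖ := by ring
        _ = N * c ^ N * ‖x - y‖ := by
          cases N with
          | zero => simp
          | succ N => rw [Nat.add_sub_cancel, pow_succ]
    rw [e]
    refine (norm_add_le _ _).trans ((add_le_add h1 h2).trans (le_of_eq ?_))
    simp only [Nat.add_sub_cancel, Nat.cast_add, Nat.cast_one]
    ring

lemma norm_exp_le [Nonempty D] (A : Matrix D D ℂ) : ‖NormedSpace.exp A‖ ≤ Real.exp ‖A‖ := by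
  rw [NormedSpace.exp_eq_tsum (𝕂 := ℝ), Real.exp_eq_exp_ℝ, NormedSpace.exp_eq_tsum (𝕂 := ℝ)]
  refine (norm_tsum_le_tsum_norm (NormedSpace.norm_expSeries_summable' (𝕂 := ℝ) A)).trans ?_
  refine (NormedSpace.norm_expSeries_summable' (𝕂 := ℝ) A).tsum_le_tsum (fun n => ?_)
    (NormedSpace.expSeries_summable' (𝕂 := ℝ) ‖A‖)
  rw [norm_smul, Real.norm_of_nonneg (by positivity), smul_eq_mul]
  gcongr
  exact norm_pow_le A n

/-- The Lie product formula. -/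
lemma tendsto_exp_mul_exp_pow [Nonempty D] (A B : Matrix D D ℂ) :
    Tendsto (fun N : ℕ => (NormedSpace.exp ((N : ℝ)⁻¹ • A) * NormedSpace.exp ((N : ℝ)⁻¹ • B)) ^ N)
      atTop (𝓝 (NormedSpace.exp (A + B))) := by
  have hd : HasDerivAt (fun t : ℝ => NormedSpace.exp (t • A) * NormedSpace.exp (t • B)
      - NormedSpace.exp (t • (A + B))) 0 0 := by
    have hA := hasDerivAt_exp_smul_const (𝕂 := ℝ) A (0 : ℝ)
    have hB := hasDerivAt_exp_smul_const (𝕂 := ℝ) B (0 : ℝ)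
    have hC := hasDerivAt_exp_smul_const (𝕂 := ℝ) (A + B) (0 : ℝ)
    have h := (hA.mul hB).sub hC
    simp only [zero_smul, NormedSpace.exp_zero, one_mul, mul_one, sub_self] at h
    exact h
  have hinv : Tendsto (fun N : ℕ => (N : ℝ)⁻¹) atTop (𝓝 0) := tendsto_inv_atTop_nhds_zero_nat
  have hlim : Tendsto (fun N : ℕ => (N : ℝ) * ‖NormedSpace.exp ((N : ℝ)⁻¹ • A)
      * NormedSpace.exp ((N : ℝ)⁻¹ • B) - NormedSpace.exp ((N : ℝ)⁻¹ • (A + B))‖)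
      atTop (𝓝 0) := by
    have h := (hasDerivAt_iff_isLittleO.1 hd).comp_tendsto hinv
    simp only [Function.comp_def, sub_zero, zero_smul, NormedSpace.exp_zero, mul_one, sub_self,
      smul_zero] at h
    have h' := h.norm_left.tendsto_div_nhds_zero
    refine h'.congr fun N => ?_
    rw [div_inv_eq_mul, mul_comm]
  have hbd (t : ℝ) (ht : 0 ≤ t) (X : Matrix D D ℂ) :
      ‖NormedSpace.exp (t • X)‖ ≤ Real.exp (t * ‖X‖) := by
    refine (norm_exp_le _).trans ?_
    rw [norm_smul, Real.norm_of_nonneg ht]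
  have hK : Tendsto (fun N : ℕ => Real.exp (‖A‖ + ‖B‖) * ((N : ℝ) * ‖NormedSpace.exp ((N : ℝ)⁻¹ • A)
      * NormedSpace.exp ((N : ℝ)⁻¹ • B) - NormedSpace.exp ((N : ℝ)⁻¹ • (A + B))‖)) atTop (𝓝 0) := by
    simpa using hlim.const_mul (Real.exp (‖A‖ + ‖B‖))
  rw [tendsto_iff_norm_sub_tendsto_zero]
  refine squeeze_zero' (Eventually.of_forall fun _ => norm_nonneg _) ?_ hK
  filter_upwards [eventually_gt_atTop 0] with N hN
  have hN' : (0 : ℝ) < N := by exact_mod_cast hN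
  have ht : (0 : ℝ) ≤ (N : ℝ)⁻¹ := by positivity
  set c := Real.exp ((N : ℝ)⁻¹ * (‖A‖ + ‖B‖)) with hc
  have hc1 : 1 ≤ c := Real.one_le_exp (by positivity)
  have hx : ‖NormedSpace.exp ((N : ℝ)⁻¹ • A) * NormedSpace.exp ((N : ℝ)⁻¹ • B)‖ ≤ c := by
    refine (norm_mul_le _ _).trans ?_
    rw [hc, mul_add, Real.exp_add]
    gcongr
    · exact hbd _ ht A
    · exact hbd _ ht B
  have hy : ‖NormedSpace.exp ((N : ℝ)⁻¹ • (A + B))‖ ≤ c := by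
    refine (hbd _ ht _).trans (Real.exp_le_exp.2 ?_)
    gcongr
    exact norm_add_le A B
  have e : NormedSpace.exp (A + B) = NormedSpace.exp ((N : ℝ)⁻¹ • (A + B)) ^ N := by
    rw [← Matrix.exp_nsmul, ← Nat.cast_smul_eq_nsmul ℝ, smul_smul, mul_inv_cancel₀ hN'.ne',
      one_smul]
  rw [e]
  refine (norm_pow_sub_pow_le hx hy N).trans ?_
  have hcN : c ^ (N - 1) ≤ Real.exp (‖A‖ + ‖B‖) := by
    calc c ^ (N - 1) ≤ c ^ N := pow_le_pow_right₀ hc1 (Nat.sub_le _ _)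
      _ = Real.exp (‖A‖ + ‖B‖) := by
        rw [hc, ← Real.exp_nat_mul, mul_inv_cancel_left₀ hN'.ne']
  rw [mul_comm (N : ℝ), mul_assoc]
  gcongr

lemma isHermitian_smul_real {D : Type*} {A : Matrix D D ℂ} (hA : A.IsHermitian) (t : ℝ) :
    (t • A).IsHermitian := by
  rw [Matrix.IsHermitian, Matrix.conjTranspose_smul, hA.eq]; simp

lemma posSemidef_exp {A : Matrix D D ℂ} (hA : A.IsHermitian) :
    (NormedSpace.exp A).PosSemidef := by
  have h := Matrix.posSemidef_self_mul_conjTranspose (NormedSpace.exp ((1 / 2 : ℝ) • A))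
  rw [(isHermitian_smul_real hA _).exp.eq, ← Matrix.exp_add_of_commute _ _ (Commute.refl _),
    ← add_smul] at h
  norm_num at h
  exact h

/-- The Golden–Thompson inequality. -/
theorem trace_exp_add_le [Nonempty D] {A B : Matrix D D ℂ} (hA : A.IsHermitian)
    (hB : B.IsHermitian) :
    (NormedSpace.exp (A + B)).trace.re ≤ (NormedSpace.exp A * NormedSpace.exp B).trace.re := by
  have h1 := (tendsto_exp_mul_exp_pow A B).comp (tendsto_pow_atTop_atTop_of_one_lt one_lt_two)
  have h2 : Tendsto (fun X : Matrix D D ℂ => X.trace.re) (𝓝 (NormedSpace.exp (A + B)))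
      (𝓝 (NormedSpace.exp (A + B)).trace.re) := by
    refine Continuous.tendsto ?_ _
    exact Complex.continuous_re.comp (continuous_id.matrix_trace)
  refine le_of_tendsto (h2.comp h1) (Eventually.of_forall fun k => ?_)
  have e (X : Matrix D D ℂ) :
      NormedSpace.exp (((2 ^ k : ℕ) : ℝ)⁻¹ • X) ^ 2 ^ k = NormedSpace.exp X := by
    rw [← Matrix.exp_nsmul, ← Nat.cast_smul_eq_nsmul ℝ, smul_smul, mul_inv_cancel₀ (by positivity),
      one_smul]
  have h3 := (norm_trace_pow_two_pow_le k).2 _ _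
    (posSemidef_exp (isHermitian_smul_real hA ((2 ^ k : ℕ) : ℝ)⁻¹))
    (posSemidef_exp (isHermitian_smul_real hB ((2 ^ k : ℕ) : ℝ)⁻¹))
  rw [e, e] at h3
  exact (Complex.re_le_norm _).trans h3

end GoldenThompson
end QTomography

/-! ### Operator inequalities for matrix exponentials -/

namespace QTomography

section TraceExp

open scoped Matrix.Norms.L2Operator MatrixOrder

variable {D : Type*} [Fintype D] [DecidableEq D]

lemma exp_le_cfc_of_forall_spectrum {A : Matrix D D ℂ} (hA : A.IsHermitian) {g : ℝ → ℝ}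
    (h : ∀ x ∈ spectrum ℝ A, Real.exp x ≤ g x) : NormedSpace.exp A ≤ cfc g A := by
  rw [← CFC.real_exp_eq_normedSpace_exp hA]
  exact cfc_mono h (by fun_prop) (by rw [continuousOn_iff_continuous_domRestrict]; fun_prop)

lemma le_of_mem_spectrum {A : Matrix D D ℂ} (hA : A.IsHermitian) {q x : ℝ}
    (h : A ≤ q • (1 : Matrix D D ℂ)) (hx : x ∈ spectrum ℝ A) : x ≤ q := by
  rw [← Algebra.algebraMap_eq_smul_one] at h
  exact (le_algebraMap_iff_spectrum_le (a := A) hA).1 h x hx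

/-- If `A ≤ 1` then `exp A ≤ 1 + A + A ^ 2`. -/
lemma exp_le_one_add_add_sq {A : Matrix D D ℂ} (hA : A.IsHermitian)
    (h : A ≤ 1) : NormedSpace.exp A ≤ 1 + A + A ^ 2 := by
  have hs : IsSelfAdjoint A := hA
  have e : cfc (fun x : ℝ => 1 + x + x ^ 2) A = 1 + A + A ^ 2 := by
    rw [cfc_add (a := A) (fun x : ℝ => 1 + x) (fun x => x ^ 2), cfc_pow_id A 2, cfc_const_add 1 _ A,
      cfc_id' ℝ A]
    simp
  rw [← e]
  refine exp_le_cfc_of_forall_spectrum hA fun x hx => ?_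
  have hx1 : x ≤ 1 := le_of_mem_spectrum hA (by simpa using h) hx
  rcases le_or_gt (-1) x with hx2 | hx2
  · have h3 := Real.abs_exp_sub_one_sub_id_le (abs_le.2 ⟨hx2, hx1⟩)
    linarith [(abs_le.1 h3).2]
  · have h3 : Real.exp x ≤ 1 := Real.exp_le_one_iff.2 (by linarith)
    nlinarith

/-- If `A ^ 2 ≤ q ≤ 1 / 4` then `exp A ≤ exp q * (1 + A)`. -/
lemma exp_le_exp_smul_one_add {A : Matrix D D ℂ} (hA : A.IsHermitian) {q : ℝ}
    (h : A ^ 2 ≤ q • (1 : Matrix D D ℂ)) (hq : q ≤ 1 / 4) :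
    NormedSpace.exp A ≤ Real.exp q • (1 + A) := by
  have hs : IsSelfAdjoint A := hA
  have e : cfc (fun x : ℝ => Real.exp q * (1 + x)) A = Real.exp q • (1 + A) := by
    rw [cfc_const_mul (Real.exp q) (fun x : ℝ => 1 + x) A, cfc_const_add 1 _ A, cfc_id' ℝ A]
    simp
  rw [← e]
  refine exp_le_cfc_of_forall_spectrum hA fun x hx => ?_
  have hx1 : x ^ 2 ≤ q := by
    refine le_of_mem_spectrum (A := A ^ 2) (hA.pow 2) h ?_
    rw [← cfc_pow_id (R := ℝ) A 2, cfc_map_spectrum (fun x : ℝ => x ^ 2) A]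
    exact ⟨x, hx, rfl⟩
  have hx2 := abs_le.1 (Real.abs_le_sqrt (hx1.trans hq))
  have hx3 : √(1 / 4 : ℝ) = 1 / 2 := by
    rw [show (1 / 4 : ℝ) = (1 / 2) ^ 2 by norm_num, Real.sqrt_sq (by norm_num)]
  rw [hx3] at hx2
  have h4 : 1 ≤ (1 + x) * Real.exp (x ^ 2 - x) := by
    rcases le_or_gt 0 x with h0 | h0
    · have h5 := Real.add_one_le_exp (x ^ 2 - x)
      have h6 : (1 + x) * (x ^ 2 - x + 1) ≤ (1 + x) * Real.exp (x ^ 2 - x) := by gcongr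
      nlinarith [pow_nonneg h0 3]
    · have h5 := Real.quadratic_le_exp_of_nonneg (x := x ^ 2 - x) (by nlinarith)
      have h6 : (1 + x) * (1 + (x ^ 2 - x) + (x ^ 2 - x) ^ 2 / 2)
          ≤ (1 + x) * Real.exp (x ^ 2 - x) := by
        gcongr; linarith
      have h7 : 0 ≤ (1 + x) * (1 - x) ^ 2 + 2 * x := by nlinarith
      nlinarith [mul_nonneg (sq_nonneg x) h7]
  calc Real.exp x = 1 * Real.exp x := (one_mul _).symm
    _ ≤ (1 + x) * Real.exp (x ^ 2 - x) * Real.exp x := by gcongr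
    _ = Real.exp (x ^ 2) * (1 + x) := by
      rw [mul_assoc, ← Real.exp_add]; ring_nf
    _ ≤ Real.exp q * (1 + x) := by
      gcongr; linarith

/-- The tangent line bound `exp A ≥ exp t * (1 + A - t)`. -/
lemma exp_smul_one_add_sub_le {A : Matrix D D ℂ} (hA : A.IsHermitian) (t : ℝ) :
    Real.exp t • (1 + A - t • (1 : Matrix D D ℂ)) ≤ NormedSpace.exp A := by
  have hs : IsSelfAdjoint A := hA
  have e : cfc (fun x : ℝ => Real.exp t * ((1 - t) + x)) A =
      Real.exp t • (1 + A - t • (1 : Matrix D D ℂ)) := by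
    rw [cfc_const_mul (Real.exp t) (fun x : ℝ => (1 - t) + x) A, cfc_const_add (1 - t) _ A,
      cfc_id' ℝ A, Algebra.algebraMap_eq_smul_one, sub_smul, one_smul]
    congr 1; abel
  rw [← e, ← CFC.real_exp_eq_normedSpace_exp hA]
  refine cfc_mono (fun x _ => ?_) (by fun_prop) (by fun_prop)
  have h1 := Real.add_one_le_exp (x - t)
  have h2 : Real.exp x = Real.exp t * Real.exp (x - t) := by rw [← Real.exp_add]; ring_nf
  rw [h2]
  gcongr
  linarith

lemma trace_mul_re_le {P A B : Matrix D D ℂ} (hP : P.PosSemidef) (h : A ≤ B) :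
    (P * A).trace.re ≤ (P * B).trace.re := by
  have h1 := trace_mul_nonneg hP (Matrix.le_iff.1 h)
  rw [mul_sub, Matrix.trace_sub, Complex.le_def] at h1
  simpa using h1.1

/-- One step of the matrix Laplace transform method: a bound on the weighted sum of the
exponentials of the increments bounds the growth of the trace exponential. -/
lemma sum_mul_trace_exp_add_le [Nonempty D] {ι : Type*} [Fintype ι] {S : Matrix D D ℂ}
    {x : ι → Matrix D D ℂ} {p : ι → ℝ} {c : ℝ} (hS : S.IsHermitian) (hx : ∀ i, (x i).IsHermitian)
    (hp : ∀ i, 0 ≤ p i) (h : ∑ i, p i • NormedSpace.exp (x i) ≤ c • (1 : Matrix D D ℂ)) :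
    ∑ i, p i * (NormedSpace.exp (S + x i)).trace.re ≤ c * (NormedSpace.exp S).trace.re := by
  calc ∑ i, p i * (NormedSpace.exp (S + x i)).trace.re
      ≤ ∑ i, p i * (NormedSpace.exp S * NormedSpace.exp (x i)).trace.re :=
        Finset.sum_le_sum fun i _ =>
          mul_le_mul_of_nonneg_left (trace_exp_add_le hS (hx i)) (hp i)
    _ = (NormedSpace.exp S * ∑ i, p i • NormedSpace.exp (x i)).trace.re := by
        simp [Finset.mul_sum, Matrix.trace_sum, Matrix.trace_smul]
    _ ≤ (NormedSpace.exp S * (c • (1 : Matrix D D ℂ))).trace.re :=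
        trace_mul_re_le (posSemidef_exp hS) h
    _ = c * (NormedSpace.exp S).trace.re := by simp [Matrix.trace_smul]

/-- The diagonal entries of `M` in the eigenbasis of a Hermitian matrix. -/
noncomputable def eigenDiag {H : Matrix D D ℂ} (hH : H.IsHermitian) (k : D)
    (M : Matrix D D ℂ) : ℂ :=
  (star (hH.eigenvectorUnitary : Matrix D D ℂ) * M * hH.eigenvectorUnitary) k k

lemma sum_eigenDiag {H : Matrix D D ℂ} (hH : H.IsHermitian) (M : Matrix D D ℂ) :
    ∑ k, eigenDiag hH k M = M.trace := by
  change Matrix.trace _ = _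
  rw [Matrix.trace_mul_comm, ← mul_assoc]
  simp

lemma eigenDiag_one {H : Matrix D D ℂ} (hH : H.IsHermitian) (k : D) :
    eigenDiag hH k 1 = 1 := by
  simp [eigenDiag]

lemma eigenDiag_cfc {H : Matrix D D ℂ} (hH : H.IsHermitian) (k : D) (f : ℝ → ℝ) :
    eigenDiag hH k (hH.cfc f) = f (hH.eigenvalues k) := by
  rw [eigenDiag, Matrix.IsHermitian.cfc, Unitary.conjStarAlgAut_apply]
  simp [← mul_assoc]
  simp [mul_assoc]

lemma eigenDiag_mono {H : Matrix D D ℂ} (hH : H.IsHermitian) (k : D) {A B : Matrix D D ℂ}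
    (h : A ≤ B) : (eigenDiag hH k A).re ≤ (eigenDiag hH k B).re := by
  have h1 := ((Matrix.le_iff.1 h).conjTranspose_mul_mul_same
    (hH.eigenvectorUnitary : Matrix D D ℂ)).diag_nonneg (i := k)
  rw [mul_sub, sub_mul, Matrix.sub_apply, Complex.le_def] at h1
  simpa [eigenDiag, Matrix.star_eq_conjTranspose] using h1.1

lemma exp_eq_cfc {H : Matrix D D ℂ} (hH : H.IsHermitian) :
    NormedSpace.exp H = hH.cfc Real.exp := by
  rw [← CFC.real_exp_eq_normedSpace_exp hH, hH.cfc_eq]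

lemma eq_cfc_id {H : Matrix D D ℂ} (hH : H.IsHermitian) : H = hH.cfc id :=
  hH.spectral_theorem

lemma trace_exp_eq {H : Matrix D D ℂ} (hH : H.IsHermitian) :
    (NormedSpace.exp H).trace.re = ∑ k, Real.exp (hH.eigenvalues k) := by
  rw [← sum_eigenDiag hH, exp_eq_cfc hH]
  simp [eigenDiag_cfc, -Complex.ofReal_exp]

/-- Jensen's inequality for the trace exponential, for the average `H` of finitely many Hermitian
matrices. -/
lemma card_mul_trace_exp_le {ι : Type*} [Fintype ι] {A : ι → Matrix D D ℂ} {H : Matrix D D ℂ}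
    (hA : ∀ i, (A i).IsHermitian) (hH : H.IsHermitian)
    (h : ∑ i, A i = (Fintype.card ι : ℝ) • H) :
    Fintype.card ι * (NormedSpace.exp H).trace.re ≤ ∑ i, (NormedSpace.exp (A i)).trace.re := by
  have h1 (i : ι) : ∑ k, Real.exp (hH.eigenvalues k) *
      (1 + (eigenDiag hH k (A i)).re - hH.eigenvalues k) ≤ (NormedSpace.exp (A i)).trace.re := by
    rw [← sum_eigenDiag hH (NormedSpace.exp (A i)), Complex.re_sum]
    refine Finset.sum_le_sum fun k _ => ?_
    have h2 := eigenDiag_mono hH k (exp_smul_one_add_sub_le (hA i) (hH.eigenvalues k))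
    refine le_trans (le_of_eq ?_) h2
    have e1 := eigenDiag_one hH k
    simp only [eigenDiag] at e1 ⊢
    simp only [mul_smul_comm, smul_mul_assoc, mul_sub, mul_add, sub_mul, add_mul,
      Matrix.smul_apply, Matrix.sub_apply, Matrix.add_apply, e1]
    simp [-Complex.ofReal_exp]
    ring
  refine le_trans (le_of_eq ?_) (Finset.sum_le_sum fun i _ => h1 i)
  rw [Finset.sum_comm, trace_exp_eq hH, Finset.mul_sum]
  refine Finset.sum_congr rfl fun k _ => ?_
  have h3 : ∑ i, (eigenDiag hH k (A i)).re = Fintype.card ι * hH.eigenvalues k := by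
    have e2 : ∑ i, eigenDiag hH k (A i) = eigenDiag hH k (∑ i, A i) := by
      simp [eigenDiag, Finset.mul_sum, Finset.sum_mul, Matrix.sum_apply]
    rw [← Complex.re_sum, e2, h]
    have e3 := eigenDiag_cfc hH k id
    rw [← eq_cfc_id hH] at e3
    simp only [eigenDiag] at e3 ⊢
    rw [mul_smul_comm, smul_mul_assoc, Matrix.smul_apply, e3]
    simp
  rw [← Finset.mul_sum, Finset.sum_sub_distrib, Finset.sum_add_distrib, h3]
  simp
  ring

lemma le_smul_one_of_trace_exp_le {S : Matrix D D ℂ} (hS : S.IsHermitian) {t : ℝ}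
    (h : (NormedSpace.exp S).trace.re ≤ Real.exp t) : S ≤ t • (1 : Matrix D D ℂ) := by
  rw [← Algebra.algebraMap_eq_smul_one]
  refine le_algebraMap_of_spectrum_le fun x hx => ?_
  rw [hS.spectrum_real_eq_range_eigenvalues] at hx
  obtain ⟨k, rfl⟩ := hx
  rw [trace_exp_eq hS] at h
  exact Real.exp_le_exp.1 ((Finset.single_le_sum (f := fun k => Real.exp (hS.eigenvalues k))
    (fun _ _ => (Real.exp_pos _).le) (Finset.mem_univ k)).trans h)

lemma norm_le_of_le_of_neg_le {S : Matrix D D ℂ} (hS : S.IsHermitian) {t : ℝ} (ht : 0 ≤ t)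
    (h1 : S ≤ t • (1 : Matrix D D ℂ)) (h2 : -S ≤ t • (1 : Matrix D D ℂ)) : ‖S‖ ≤ t := by
  have h3 : ‖S‖ = ‖(Matrix.diagonal (RCLike.ofReal ∘ hS.eigenvalues) : Matrix D D ℂ)‖ := by
    rw [← hS.conjStarAlgAut_star_eigenvectorUnitary, Unitary.conjStarAlgAut_apply,
      ← Unitary.coe_star, CStarRing.norm_mul_coe_unitary, CStarRing.norm_coe_unitary_mul]
  rw [h3, Matrix.l2_opNorm_diagonal]
  refine (pi_norm_le_iff_of_nonneg ht).2 fun k => ?_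
  have hk := hS.eigenvalues_mem_spectrum_real k
  have h4 := le_of_mem_spectrum hS h1 hk
  have h5 := le_of_mem_spectrum hS.neg h2 (x := -hS.eigenvalues k) (by
    rw [← spectrum.neg_eq]; simpa using hk)
  simp only [Function.comp_apply, RCLike.norm_ofReal]
  exact abs_le.2 ⟨by linarith, h4⟩

end TraceExp
end QTomography

/-! ### Sampling with and without replacement -/

namespace QTomography

section Sampling

/-- The probability of an event under the uniform distribution on a finite type. -/
noncomputable def uniformProb {Ω : Type*} (P : Ω → Prop) : ℝ :=
  (Nat.card {x : Ω // P x} : ℝ) / (Nat.card Ω : ℝ)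

lemma drawProb_eq_uniformProb (n m : ℕ) (P : (Fin m ↪ PauliLabel n) → Prop) :
    drawProb n m P = uniformProb P := rfl

variable {Ω : Type*} [Fintype Ω]

lemma uniformProb_eq_sum (P : Ω → Prop) [DecidablePred P] :
    uniformProb P = (∑ x, if P x then (1 : ℝ) else 0) / Fintype.card Ω := by
  rw [uniformProb, Nat.card_eq_fintype_card, Nat.card_eq_fintype_card, Fintype.card_subtype,
    Finset.sum_boole]

lemma uniformProb_le_one (P : Ω → Prop) : uniformProb P ≤ 1 := by
  classical
  rw [uniformProb, Nat.card_eq_fintype_card, Nat.card_eq_fintype_card]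
  exact div_le_one_of_le₀ (by exact_mod_cast Fintype.card_subtype_le P) (by positivity)

lemma uniformProb_mono {P Q : Ω → Prop} (h : ∀ x, P x → Q x) :
    uniformProb P ≤ uniformProb Q := by
  rw [uniformProb, uniformProb]
  gcongr
  exact Nat.card_le_card_of_injective _ (Subtype.map_injective h Function.injective_id)

lemma uniformProb_le_add {P Q R : Ω → Prop} (h : ∀ x, P x → Q x ∨ R x) :
    uniformProb P ≤ uniformProb Q + uniformProb R := by
  classical
  rw [uniformProb_eq_sum, uniformProb_eq_sum, uniformProb_eq_sum, ← add_div,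
    ← Finset.sum_add_distrib]
  gcongr with x
  by_cases hP : P x
  · rcases h x hP with hx | hx
    · by_cases hR : R x <;> simp [hP, hx, hR]
    · by_cases hQ : Q x <;> simp [hP, hx, hQ]
  · simp only [hP, if_false]; positivity

/-- Markov's inequality. -/
lemma uniformProb_le_div {P : Ω → Prop} {f : Ω → ℝ} {t s : ℝ} (ht : 0 < t) (hf : ∀ x, 0 ≤ f x)
    (h : ∀ x, P x → t ≤ f x) (hs : ∑ x, f x ≤ Fintype.card Ω * s) (hs0 : 0 ≤ s) :
    uniformProb P ≤ s / t := by
  classical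
  rw [uniformProb_eq_sum]
  refine div_le_of_le_mul₀ (by positivity) (by positivity) ?_
  rw [div_mul_eq_mul_div, le_div_iff₀ ht, Finset.sum_mul]
  refine le_trans (Finset.sum_le_sum fun x _ => ?_) (hs.trans (le_of_eq (mul_comm _ _)))
  by_cases hP : P x
  · simpa [hP] using h x hP
  · simpa [hP] using hf x

lemma sum_perm_apply_congr {M α : Type*} [AddCommMonoid M] [Fintype α] [DecidableEq α]
    (h : α → M) (k l : α) :
    ∑ τ : Equiv.Perm α, h (τ k) = ∑ τ : Equiv.Perm α, h (τ l) :=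
  Fintype.sum_equiv (Equiv.mulRight (Equiv.swap l k)) _ _ fun τ => by simp

lemma card_smul_sum_perm_apply {M α : Type*} [AddCommMonoid M] [Fintype α] [DecidableEq α]
    (h : α → M) (k : α) :
    Fintype.card α • ∑ τ : Equiv.Perm α, h (τ k) =
      Fintype.card (Equiv.Perm α) • ∑ a, h a := by
  calc Fintype.card α • ∑ τ : Equiv.Perm α, h (τ k)
      = ∑ l : α, ∑ τ : Equiv.Perm α, h (τ l) := by
        rw [Finset.sum_congr rfl fun l _ => sum_perm_apply_congr h l k]
        simp
    _ = ∑ τ : Equiv.Perm α, ∑ a, h a := by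
        rw [Finset.sum_comm]
        exact Finset.sum_congr rfl fun τ _ => Equiv.sum_comp τ h
    _ = _ := by simp

variable {α : Type*} [Fintype α] [DecidableEq α] {m : ℕ}

lemma exists_perm_trans_eq {α : Type*} {m : ℕ} (e e' : Fin m ↪ α) :
    ∃ τ : Equiv.Perm α, e.trans τ.toEmbedding = e' := by
  obtain ⟨τ, hτ⟩ := (Equiv.Perm.isMultiplyPretransitive α m).exists_smul_eq e e'
  refine ⟨τ, ?_⟩
  rw [← hτ]
  ext i
  rfl

/-- The image of a fixed injective map under a uniformly random permutation is a uniformly random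
injective map. -/
lemma card_mul_sum_perm_trans (φ : (Fin m ↪ α) → ℝ) (e : Fin m ↪ α) :
    Fintype.card (Fin m ↪ α) * ∑ π : Equiv.Perm α, φ (e.trans π.toEmbedding) =
      Fintype.card (Equiv.Perm α) * ∑ A, φ A := by
  have h (e' : Fin m ↪ α) : ∑ π : Equiv.Perm α, φ (e.trans π.toEmbedding) =
      ∑ π : Equiv.Perm α, φ (e'.trans π.toEmbedding) := by
    obtain ⟨τ, rfl⟩ := exists_perm_trans_eq e e'
    refine (Fintype.sum_equiv (Equiv.mulRight τ) _ _ fun π => ?_).symm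
    rfl
  calc Fintype.card (Fin m ↪ α) * ∑ π : Equiv.Perm α, φ (e.trans π.toEmbedding)
      = ∑ e' : Fin m ↪ α, ∑ π : Equiv.Perm α, φ (e'.trans π.toEmbedding) := by
        rw [← Finset.sum_congr rfl fun e' _ => h e']
        simp
    _ = ∑ π : Equiv.Perm α, ∑ A, φ A := by
        rw [Finset.sum_comm]
        refine Finset.sum_congr rfl fun π _ => ?_
        exact Equiv.sum_comp (Equiv.embeddingCongr (Equiv.refl (Fin m)) π) φ
    _ = _ := by simp

/-- The mean of a function at one draw of a sample without replacement. -/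
lemma card_mul_sum_embedding_apply (g : α → ℝ) (i : Fin m) (hm : m ≤ Fintype.card α) :
    Fintype.card α * ∑ A : Fin m ↪ α, g (A i) = Fintype.card (Fin m ↪ α) * ∑ a, g a := by
  obtain ⟨e⟩ := Function.Embedding.nonempty_of_card_le (α := Fin m) (β := α) (by simpa using hm)
  have h1 := card_mul_sum_perm_trans (fun A => g (A i)) e
  have h2 := card_smul_sum_perm_apply g (e i)
  simp only [nsmul_eq_mul, Function.Embedding.trans_apply, Equiv.coe_toEmbedding] at h1 h2
  have hP : (Fintype.card (Equiv.Perm α) : ℝ) ≠ 0 := by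
    exact_mod_cast Fintype.card_ne_zero
  refine mul_left_cancel₀ hP ?_
  linear_combination (-(Fintype.card α : ℝ)) * h1 + (Fintype.card (Fin m ↪ α) : ℝ) * h2

/-- Every sample with replacement is a resampling of a sample of the same size without
replacement. -/
lemma exists_embedding_comp_eq (hm : m ≤ Fintype.card α) (f : Fin m → α) :
    ∃ (e : Fin m ↪ α) (g : Fin m → Fin m), ⇑e ∘ g = f := by
  obtain ⟨t, ht, htc⟩ := Finset.exists_superset_card_eq
    (s := Finset.univ.image f) (n := m) (Finset.card_image_le.trans (by simp)) hm
  let E := (t.equivFinOfCardEq htc)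
  have hf (j : Fin m) : f j ∈ t := ht (Finset.mem_image_of_mem f (Finset.mem_univ j))
  refine ⟨E.symm.toEmbedding.trans (Function.Embedding.subtype _), fun j => E ⟨f j, hf j⟩, ?_⟩
  ext j
  simp

/-- Comparison of sampling without replacement (`φ`) and with replacement (`ψ`): it suffices to
compare a sample without replacement with the resamplings `e ∘ τ ∘ g` of it, averaged over the
permutations `τ`. -/
lemma avg_embedding_le_avg_fun (hm : m ≤ Fintype.card α) {φ : (Fin m ↪ α) → ℝ}
    {ψ : (Fin m → α) → ℝ}
    (h : ∀ (e : Fin m ↪ α) (g : Fin m → Fin m),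
      Fintype.card (Equiv.Perm (Fin m)) * φ e ≤ ∑ τ : Equiv.Perm (Fin m), ψ (e ∘ τ ∘ g)) :
    Fintype.card (Fin m → α) * ∑ A, φ A ≤ Fintype.card (Fin m ↪ α) * ∑ f, ψ f := by
  have hfac : (0 : ℝ) < Fintype.card (Equiv.Perm (Fin m)) := by exact_mod_cast Fintype.card_pos
  have hfac' : (0 : ℝ) < Fintype.card (Equiv.Perm α) := by exact_mod_cast Fintype.card_pos
  have key (f : Fin m → α) : Fintype.card (Equiv.Perm α) * ∑ A, φ A ≤
      Fintype.card (Fin m ↪ α) * ∑ π : Equiv.Perm α, ψ (π ∘ f) := by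
    obtain ⟨e, g, rfl⟩ := exists_embedding_comp_eq hm f
    rw [← card_mul_sum_perm_trans φ e]
    refine mul_le_mul_of_nonneg_left ?_ (by positivity)
    have h1 (τ : Equiv.Perm (Fin m)) : ∑ π : Equiv.Perm α, ψ (π ∘ e ∘ τ ∘ g) =
        ∑ π : Equiv.Perm α, ψ (π ∘ e ∘ g) := by
      obtain ⟨τ', hτ'⟩ := exists_perm_trans_eq e (τ.toEmbedding.trans e)
      refine Fintype.sum_equiv (Equiv.mulRight τ') _ _ fun π => ?_
      congr 1
      ext j
      have := DFunLike.congr_fun hτ' (g j)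
      simp at this
      simp [this]
    have h2 : Fintype.card (Equiv.Perm (Fin m)) *
        ∑ π : Equiv.Perm α, φ (e.trans π.toEmbedding) ≤
        Fintype.card (Equiv.Perm (Fin m)) * ∑ π : Equiv.Perm α, ψ (π ∘ e ∘ g) := by
      calc _ ≤ ∑ π : Equiv.Perm α, ∑ τ : Equiv.Perm (Fin m), ψ (π ∘ e ∘ τ ∘ g) := by
            rw [Finset.mul_sum]
            exact Finset.sum_le_sum fun π _ => h (e.trans π.toEmbedding) g
        _ = _ := by
            rw [Finset.sum_comm, Finset.sum_congr rfl fun τ _ => h1 τ]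
            simp
    exact le_of_mul_le_mul_left h2 hfac
  have h3 : ∑ f : Fin m → α, ∑ π : Equiv.Perm α, ψ (π ∘ f) =
      Fintype.card (Equiv.Perm α) * ∑ f, ψ f := by
    rw [Finset.sum_comm]
    have h4 (π : Equiv.Perm α) : ∑ f : Fin m → α, ψ (π ∘ f) = ∑ f, ψ f :=
      Equiv.sum_comp (Equiv.arrowCongr (Equiv.refl (Fin m)) π) ψ
    rw [Finset.sum_congr rfl fun π _ => h4 π]
    simp
  have h4 := Finset.sum_le_sum fun (f : Fin m → α) (_ : f ∈ Finset.univ) => key f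
  rw [← Finset.mul_sum (f := fun f : Fin m → α => ∑ π : Equiv.Perm α, ψ (π ∘ f)), h3] at h4
  simp only [Finset.sum_const, Finset.card_univ, nsmul_eq_mul] at h4
  refine le_of_mul_le_mul_left ?_ hfac'
  linarith

/-- An event that is antitone in the set of sampled labels is at most as likely without
replacement as with replacement. -/
lemma uniformProb_embedding_le_uniformProb_fun (hm : m ≤ Fintype.card α) [Nonempty α]
    {P : Set α → Prop} (hP : ∀ s t, s ⊆ t → P t → P s) :
    uniformProb (fun A : Fin m ↪ α => P (Set.range A)) ≤
      uniformProb (fun f : Fin m → α => P (Set.range f)) := by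
  classical
  obtain ⟨e₀⟩ := Function.Embedding.nonempty_of_card_le (α := Fin m) (β := α) (by simpa using hm)
  have : Nonempty (Fin m ↪ α) := ⟨e₀⟩
  have h := avg_embedding_le_avg_fun hm (α := α) (m := m)
    (φ := fun A => if P (Set.range A) then 1 else 0)
    (ψ := fun f => if P (Set.range f) then 1 else 0) (fun e g => by
      rw [← nsmul_eq_mul, ← Finset.card_univ, ← Finset.sum_const]
      refine Finset.sum_le_sum fun τ _ => ?_
      by_cases he : P (Set.range e)
      · have : P (Set.range (e ∘ τ ∘ g)) := hP _ _ (Set.range_comp_subset_range _ _) he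
        simp [he, this]
      · simp only [he, if_false]; positivity)
  rw [uniformProb_eq_sum, uniformProb_eq_sum, div_le_div_iff₀
    (by exact_mod_cast Fintype.card_pos) (by exact_mod_cast Fintype.card_pos)]
  linarith

end Sampling

section Supermartingale

variable {α : Type*}

/-- The state reached from `s` when the steps labelled `f 0, f 1, …` are made in turn. -/
def iterSteps {σ : Type*} (step : α → σ → σ) : (k : ℕ) → σ → (Fin k → α) → σ
  | 0, s, _ => s
  | k + 1, s, f => iterSteps step k (step (f 0) s) (Fin.tail f)

lemma iterSteps_induction {σ : Type*} {step : α → σ → σ} {I : σ → Prop}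
    (hI : ∀ a s, I s → I (step a s)) {k : ℕ} {s : σ} (hs : I s) (f : Fin k → α) :
    I (iterSteps step k s f) := by
  induction k generalizing s with
  | zero => exact hs
  | succ k ih => exact ih (hI _ _ hs) _

variable [Fintype α]

/-- The exponential supermartingale bound: a potential that on average grows at most by the factor
`ρ` in each step grows on average at most by `ρ ^ k` in `k` independent steps. -/
lemma sum_iterSteps_le {σ : Type*} {step : α → σ → σ} {I : σ → Prop}
    (hI : ∀ a s, I s → I (step a s)) {Φ : σ → ℝ} {ρ : ℝ} (hρ : 0 ≤ ρ)
    (hΦ : ∀ s, I s → ∑ a, Φ (step a s) ≤ Fintype.card α * (ρ * Φ s)) {k : ℕ} {s : σ} (hs : I s) :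
    ∑ f, Φ (iterSteps step k s f) ≤ Fintype.card (Fin k → α) * (ρ ^ k * Φ s) := by
  induction k generalizing s with
  | zero => simp [iterSteps]
  | succ k ih =>
    rw [← Equiv.sum_comp (Fin.consEquiv fun _ => α), Fintype.sum_prod_type]
    simp only [Fin.consEquiv, Equiv.coe_fn_mk, iterSteps, Fin.cons_zero, Fin.tail_cons]
    calc ∑ a, ∑ f, Φ (iterSteps step k (step a s) f)
        ≤ ∑ a, Fintype.card (Fin k → α) * (ρ ^ k * Φ (step a s)) :=
          Finset.sum_le_sum fun a _ => ih (hI a s hs)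
      _ = Fintype.card (Fin k → α) * (ρ ^ k * ∑ a, Φ (step a s)) := by
          rw [Finset.mul_sum, Finset.mul_sum]
      _ ≤ Fintype.card (Fin k → α) * (ρ ^ k * (Fintype.card α * (ρ * Φ s))) := by
          gcongr; exact hΦ s hs
      _ = _ := by
          simp only [Fintype.card_fun, Fintype.card_fin]
          push_cast
          ring

end Supermartingale
end QTomography

/-! ### A matrix Chernoff bound for the lower tail -/

namespace QTomography

section Chernoff

open scoped Matrix.Norms.L2Operator MatrixOrder

variable {D : Type*} [Fintype D]

lemma le_of_forall_re_le {A B : Matrix D D ℂ} (hA : A.IsHermitian) (hB : B.IsHermitian)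
    (h : ∀ z : D → ℂ, (star z ⬝ᵥ A *ᵥ z).re ≤ (star z ⬝ᵥ B *ᵥ z).re) : A ≤ B := by
  rw [Matrix.le_iff]
  refine Matrix.PosSemidef.of_dotProduct_mulVec_nonneg (hB.sub hA) fun z => ?_
  have him := (hB.sub hA).im_star_dotProduct_mulVec_self z
  rw [Complex.le_def]
  refine ⟨?_, him.symm⟩
  rw [Matrix.sub_mulVec, dotProduct_sub, Complex.sub_re]
  simpa using h z

lemma re_dotProduct_mulVec_le {A B : Matrix D D ℂ} (h : A ≤ B) (z : D → ℂ) :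
    (star z ⬝ᵥ A *ᵥ z).re ≤ (star z ⬝ᵥ B *ᵥ z).re := by
  have h1 := (Matrix.le_iff.1 h).dotProduct_mulVec_nonneg z
  rw [Matrix.sub_mulVec, dotProduct_sub, Complex.le_def] at h1
  simpa using h1.1

lemma star_dotProduct_self_re (z : D → ℂ) : (star z ⬝ᵥ z).re = ∑ i, ‖z i‖ ^ 2 := by
  simp [dotProduct, Complex.conj_mul', ← Complex.ofReal_pow]

lemma re_dotProduct_vecMulVec_mulVec (u z : D → ℂ) :
    (star z ⬝ᵥ Matrix.vecMulVec u (star u) *ᵥ z).re = ‖star u ⬝ᵥ z‖ ^ 2 := by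
  rw [Matrix.vecMulVec_mulVec]
  have h : star z ⬝ᵥ u = star (star u ⬝ᵥ z) := by
    rw [← Matrix.star_dotProduct_star, star_star]
  simp [h, ← Complex.normSq_eq_norm_sq, Complex.normSq_apply]

variable [DecidableEq D]

lemma re_dotProduct_smul_one_mulVec (t : ℝ) (z : D → ℂ) :
    (star z ⬝ᵥ (t • (1 : Matrix D D ℂ)) *ᵥ z).re = t * ∑ i, ‖z i‖ ^ 2 := by
  rw [Matrix.smul_mulVec, dotProduct_smul, Matrix.one_mulVec, Complex.smul_re,
    star_dotProduct_self_re, smul_eq_mul]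

lemma vecMulVec_sq (u : D → ℂ) : Matrix.vecMulVec u (star u) ^ 2 =
    (∑ i, ‖u i‖ ^ 2) • Matrix.vecMulVec u (star u) := by
  have h : star u ⬝ᵥ u = ((∑ i, ‖u i‖ ^ 2 : ℝ) : ℂ) := by
    simp [dotProduct, Complex.conj_mul']
  rw [pow_two, Matrix.vecMulVec_mul_vecMulVec, h]
  ext i j
  simp [Matrix.vecMulVec_apply]
  ring

/-- The trace exponential of a sum sampled with replacement from Hermitian matrices whose
exponentials average to at most `ρ`. -/
lemma sum_trace_exp_sum_le [Nonempty D] {α : Type*} [Fintype α] {X : α → Matrix D D ℂ}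
    (hX : ∀ a, (X a).IsHermitian) {ρ : ℝ} (hρ : 0 ≤ ρ)
    (h : ∑ a, NormedSpace.exp (X a) ≤ (Fintype.card α * ρ) • (1 : Matrix D D ℂ)) (m : ℕ) :
    ∑ f : Fin m → α, (NormedSpace.exp (∑ j, X (f j))).trace.re ≤
      Fintype.card (Fin m → α) * (ρ ^ m * Fintype.card D) := by
  have hrun (k : ℕ) (s : Matrix D D ℂ) (f : Fin k → α) :
      iterSteps (fun a s => s + X a) k s f = s + ∑ j, X (f j) := by
    induction k generalizing s with
    | zero => simp [iterSteps]
    | succ k ih => rw [iterSteps, ih, Fin.sum_univ_succ, add_assoc]; rfl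
  have h1 := sum_iterSteps_le (step := fun a s => s + X a) (I := Matrix.IsHermitian)
    (fun a s hs => hs.add (hX a)) (Φ := fun s => (NormedSpace.exp s).trace.re) hρ
    (fun s hs => by
      have h2 := sum_mul_trace_exp_add_le hs hX (p := fun _ => 1) (fun _ => zero_le_one)
        (by simpa using h)
      simp only [one_mul] at h2
      rwa [mul_assoc] at h2) (k := m) Matrix.isHermitian_zero
  simpa [hrun, Matrix.trace_one] using h1

/-- Hoeffding's comparison for trace exponentials: sampling without replacement does not increase
the mean of the trace exponential of a sum. -/
lemma sum_trace_exp_embedding_le {α : Type*} [Fintype α] [DecidableEq α] {X : α → Matrix D D ℂ}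
    (hX : ∀ a, (X a).IsHermitian) {m : ℕ} (hm : m ≤ Fintype.card α) :
    Fintype.card (Fin m → α) * ∑ A : Fin m ↪ α, (NormedSpace.exp (∑ j, X (A j))).trace.re ≤
      Fintype.card (Fin m ↪ α) * ∑ f : Fin m → α, (NormedSpace.exp (∑ j, X (f j))).trace.re := by
  refine avg_embedding_le_avg_fun hm (ψ := fun f => (NormedSpace.exp (∑ j, X (f j))).trace.re)
    fun e g => ?_
  have hsum (f : Fin m → α) : (∑ j, X (f j)).IsHermitian :=
    isSelfAdjoint_sum _ fun j _ => hX (f j)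
  refine card_mul_trace_exp_le (fun τ => hsum (e ∘ τ ∘ g)) (hsum e) ?_
  rw [Finset.sum_comm]
  simp only [Function.comp_apply]
  rw [Finset.sum_congr rfl fun j _ => sum_perm_apply_congr (fun k => X (e k)) (g j) j,
    Finset.sum_comm, Finset.sum_congr rfl fun τ _ => Equiv.sum_comp τ fun k => X (e k)]
  simp [Nat.cast_smul_eq_nsmul]

/-- A matrix Chernoff bound for the lower tail of a sum of rank-one matrices `u a (u a)ᴴ` sampled
without replacement: except with small probability, the quadratic form of the sum is everywhere at
least its mean minus `m * μ / 2`. -/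
lemma uniformProb_exists_quadratic_lt_le [Nonempty D] {α : Type*} [Fintype α] [DecidableEq α]
    [Nonempty α] (u : α → D → ℂ) {β μ : ℝ} (hμ : 0 < μ) (hμβ : μ ≤ 4 * β)
    (hβ : ∀ a, ∑ i, ‖u a i‖ ^ 2 ≤ β)
    (hu : ∀ z, ∑ a, ‖star (u a) ⬝ᵥ z‖ ^ 2 ≤ Fintype.card α * μ * ∑ i, ‖z i‖ ^ 2)
    {m : ℕ} (hm : m ≤ Fintype.card α) :
    uniformProb (fun A : Fin m ↪ α => ∃ z, ∑ j, ‖star (u (A j)) ⬝ᵥ z‖ ^ 2 <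
        m * ((∑ a, ‖star (u a) ⬝ᵥ z‖ ^ 2) / Fintype.card α) - m * μ / 2 * ∑ i, ‖z i‖ ^ 2) ≤
      Fintype.card D * Real.exp (-(m * μ / (16 * β))) := by
  set N : ℝ := ((Fintype.card α : ℕ) : ℝ) with hN
  have hN0 : 0 < N := by rw [hN]; exact_mod_cast Fintype.card_pos
  have hβ0 : 0 < β := by linarith
  set U : α → Matrix D D ℂ := fun a => Matrix.vecMulVec (u a) (star (u a)) with hU
  have hUp (a : α) : (U a).PosSemidef := Matrix.posSemidef_vecMulVec_self_star (u a)
  have hUh (a : α) : (U a).IsHermitian := (hUp a).1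
  set M : Matrix D D ℂ := N⁻¹ • ∑ a, U a with hM
  have hsumU : (∑ a, U a).IsHermitian := isSelfAdjoint_sum _ fun a _ => hUh a
  have hMh : M.IsHermitian := isHermitian_smul_real hsumU _
  have hsum : ∑ a, U a = N • M := by rw [hM, smul_smul, mul_inv_cancel₀ hN0.ne', one_smul]
  have hquadM (z : D → ℂ) : (star z ⬝ᵥ M *ᵥ z).re = (∑ a, ‖star (u a) ⬝ᵥ z‖ ^ 2) / N := by
    rw [hM, Matrix.smul_mulVec, dotProduct_smul, Matrix.sum_mulVec, dotProduct_sum]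
    rw [Complex.smul_re, Complex.re_sum, smul_eq_mul, inv_mul_eq_div]
    congr 1
    exact Finset.sum_congr rfl fun a _ => re_dotProduct_vecMulVec_mulVec (u a) z
  have hMμ : M ≤ μ • (1 : Matrix D D ℂ) := by
    refine le_of_forall_re_le hMh (isHermitian_smul_real Matrix.isHermitian_one _) fun z => ?_
    rw [hquadM, re_dotProduct_smul_one_mulVec, div_le_iff₀ hN0]
    linarith [hu z]
  -- the Laplace transform is taken of the deviations below the mean, at the parameter `θ`
  set θ : ℝ := 1 / (4 * β) with hθ
  have hθ0 : 0 < θ := by positivity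
  have hθμ : θ * μ ≤ 1 := by
    rw [hθ, div_mul_eq_mul_div, one_mul, div_le_one (by positivity)]; exact hμβ
  set X : α → Matrix D D ℂ := fun a => θ • (M - U a) with hX
  have hXh (a : α) : (X a).IsHermitian := isHermitian_smul_real (hMh.sub (hUh a)) _
  have hX1 (a : α) : X a ≤ 1 := by
    refine le_of_forall_re_le (hXh a) Matrix.isHermitian_one fun z => ?_
    have h1 := re_dotProduct_mulVec_le hMμ z
    have h2 := (hUp a).re_dotProduct_nonneg z
    have h3 : 0 ≤ ∑ i, ‖z i‖ ^ 2 := by positivity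
    rw [re_dotProduct_smul_one_mulVec] at h1
    rw [hX, Matrix.smul_mulVec, dotProduct_smul, Matrix.one_mulVec, Complex.smul_re,
      star_dotProduct_self_re, smul_eq_mul, Matrix.sub_mulVec, dotProduct_sub, Complex.sub_re]
    simp only [RCLike.re_to_complex] at h2
    calc _ ≤ θ * (μ * ∑ i, ‖z i‖ ^ 2) := by gcongr; linarith
      _ = (θ * μ) * ∑ i, ‖z i‖ ^ 2 := by ring
      _ ≤ _ := mul_le_of_le_one_left h3 hθμ
  have hXsum : ∑ a, X a = 0 := by
    rw [hX, ← Finset.smul_sum, Finset.sum_sub_distrib, hsum]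
    simp [hN, Nat.cast_smul_eq_nsmul]
  have hXsq : ∑ a, X a ^ 2 ≤ (N * (θ ^ 2 * β * μ)) • (1 : Matrix D D ℂ) := by
    have e1 : ∑ a, X a ^ 2 = θ ^ 2 • (∑ a, U a ^ 2 - N • M ^ 2) := by
      have e2 (a : α) : X a ^ 2 = θ ^ 2 • (M ^ 2 - M * U a - U a * M + U a ^ 2) := by
        simp only [hX, smul_pow]
        congr 1
        simp only [pow_two]
        noncomm_ring
      simp only [e2]
      rw [← Finset.smul_sum]
      congr 1
      rw [Finset.sum_add_distrib, Finset.sum_sub_distrib, Finset.sum_sub_distrib,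
        ← Finset.mul_sum, ← Finset.sum_mul, hsum]
      simp only [Finset.sum_const, Finset.card_univ, mul_smul_comm, smul_mul_assoc, ← pow_two,
        ← Nat.cast_smul_eq_nsmul ℝ, ← hN]
      abel
    have e3 (a : α) : U a ^ 2 ≤ β • U a := by
      rw [hU]
      simp only
      rw [vecMulVec_sq, Matrix.le_iff, ← sub_smul]
      exact (hUp a).smul (sub_nonneg.2 (hβ a))
    have e4 : (0 : Matrix D D ℂ) ≤ M ^ 2 := by
      rw [Matrix.nonneg_iff_posSemidef, pow_two]
      nth_rw 1 [← hMh.eq]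
      exact Matrix.posSemidef_conjTranspose_mul_self M
    have hsmul {A B : Matrix D D ℂ} {t : ℝ} (ht : 0 ≤ t) (h : A ≤ B) : t • A ≤ t • B := by
      rw [Matrix.le_iff, ← smul_sub]
      exact (Matrix.le_iff.1 h).smul ht
    rw [e1]
    calc θ ^ 2 • (∑ a, U a ^ 2 - N • M ^ 2) ≤ θ ^ 2 • (∑ a, β • U a) := by
          refine hsmul (by positivity) ?_
          have := hsmul hN0.le e4
          rw [smul_zero] at this
          exact (sub_le_self _ this).trans (Finset.sum_le_sum fun a _ => e3 a)
      _ = (N * (θ ^ 2 * β)) • M := by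
          rw [← Finset.smul_sum, hsum, smul_smul, smul_smul]; congr 1; ring
      _ ≤ (N * (θ ^ 2 * β)) • (μ • (1 : Matrix D D ℂ)) := hsmul (by positivity) hMμ
      _ = _ := by rw [smul_smul]; congr 1; ring
  set v : ℝ := θ ^ 2 * β * μ with hv
  have hexp : ∑ a, NormedSpace.exp (X a) ≤ (N * Real.exp v) • (1 : Matrix D D ℂ) := by
    calc ∑ a, NormedSpace.exp (X a) ≤ ∑ a, (1 + X a + X a ^ 2) :=
          Finset.sum_le_sum fun a _ => exp_le_one_add_add_sq (hXh a) (hX1 a)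
      _ = N • (1 : Matrix D D ℂ) + ∑ a, X a ^ 2 := by
          rw [Finset.sum_add_distrib, Finset.sum_add_distrib, hXsum,
            add_zero, Finset.sum_const, Finset.card_univ, ← Nat.cast_smul_eq_nsmul ℝ]
      _ ≤ N • (1 : Matrix D D ℂ) + (N * v) • (1 : Matrix D D ℂ) := by gcongr
      _ = (N * (1 + v)) • (1 : Matrix D D ℂ) := by rw [← add_smul]; congr 1; ring
      _ ≤ _ := by
          rw [Matrix.le_iff, ← sub_smul]
          refine Matrix.PosSemidef.one.smul (sub_nonneg.2 ?_)
          gcongr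
          linarith [Real.add_one_le_exp v]
  have h1 := sum_trace_exp_sum_le hXh (Real.exp_pos v).le hexp m
  have h2 := (sum_trace_exp_embedding_le hXh hm).trans
    (mul_le_mul_of_nonneg_left h1 (Nat.cast_nonneg _))
  have hcf : (0 : ℝ) < Fintype.card (Fin m → α) := by exact_mod_cast Fintype.card_pos
  have h3 : ∑ A : Fin m ↪ α, (NormedSpace.exp (∑ j, X (A j))).trace.re ≤
      Fintype.card (Fin m ↪ α) * (Real.exp v ^ m * Fintype.card D) := by
    refine le_of_mul_le_mul_left (h2.trans (le_of_eq ?_)) hcf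
    ring
  have hsumh (A : Fin m ↪ α) : (∑ j, X (A j)).IsHermitian :=
    isSelfAdjoint_sum _ fun j _ => hXh (A j)
  set t : ℝ := θ * (m * μ / 2) with ht
  have h4 := uniformProb_le_div (P := fun A : Fin m ↪ α => ∃ z, ∑ j, ‖star (u (A j)) ⬝ᵥ z‖ ^ 2 <
        m * ((∑ a, ‖star (u a) ⬝ᵥ z‖ ^ 2) / N) - m * μ / 2 * ∑ i, ‖z i‖ ^ 2)
    (Real.exp_pos t) (fun A => by
      rw [trace_exp_eq (hsumh A)]
      exact Finset.sum_nonneg fun k _ => (Real.exp_pos _).le) (fun A hA => ?_) h3 (by positivity)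
  · refine h4.trans (le_of_eq ?_)
    rw [← Real.exp_nat_mul, mul_comm (Real.exp _), mul_div_assoc, ← Real.exp_sub]
    congr 2
    rw [ht, hv, hθ]
    field_simp
    ring
  · obtain ⟨z, hz⟩ := hA
    by_contra! hlt
    have h5 := re_dotProduct_mulVec_le (le_smul_one_of_trace_exp_le (hsumh A) hlt.le) z
    rw [re_dotProduct_smul_one_mulVec, Matrix.sum_mulVec, dotProduct_sum,
      Complex.re_sum] at h5
    have h6 (j : Fin m) : (star z ⬝ᵥ X (A j) *ᵥ z).re =
        θ * ((∑ a, ‖star (u a) ⬝ᵥ z‖ ^ 2) / N - ‖star (u (A j)) ⬝ᵥ z‖ ^ 2) := by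
      rw [hX, Matrix.smul_mulVec, dotProduct_smul, Complex.smul_re, smul_eq_mul,
        Matrix.sub_mulVec, dotProduct_sub, Complex.sub_re, hquadM,
        re_dotProduct_vecMulVec_mulVec]
    rw [Finset.sum_congr rfl fun j _ => h6 j, ← Finset.mul_sum, Finset.sum_sub_distrib, ht,
      mul_assoc] at h5
    simp only [Finset.sum_const, Finset.card_univ, Fintype.card_fin, nsmul_eq_mul] at h5
    have h7 := le_of_mul_le_mul_left h5 hθ0
    linarith

end Chernoff
end QTomography

/-! ### The Pauli basis and the sampling operator -/

namespace QTomography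

section Pauli

open scoped Matrix.Norms.L2Operator MatrixOrder

lemma conj_pauli (a : Fin 4) (i j : Fin 2) : star (pauli a i j) = pauli a j i := by
  fin_cases a <;> fin_cases i <;> fin_cases j <;> simp [pauli]

lemma pauli_mul_self (a : Fin 4) : pauli a * pauli a = 1 := by
  fin_cases a <;> simp [pauli, Matrix.one_fin_two]

lemma trace_pauli_mul (a b : Fin 4) :
    (pauli a * pauli b).trace = if a = b then 2 else 0 := by
  fin_cases a <;> fin_cases b <;> simp [pauli, Matrix.trace_fin_two, Matrix.one_fin_two] <;>
    norm_num

lemma sum_pauli_mul_pauli (i j k l : Fin 2) :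
    ∑ a, pauli a i j * pauli a l k = if i = k ∧ j = l then 2 else 0 := by
  fin_cases i <;> fin_cases j <;> fin_cases k <;> fin_cases l <;>
    simp [pauli, Fin.sum_univ_four, Matrix.one_fin_two] <;> norm_num

variable {n : ℕ}

lemma isHermitian_pauliString (a : PauliLabel n) : (pauliString a).IsHermitian := by
  ext i j
  simp [pauliString, Matrix.conjTranspose_apply, ← conj_pauli _ (j _) (i _)]

lemma pauliString_mul_apply (a b : PauliLabel n) (i j : Fin n → Fin 2) :
    (pauliString a * pauliString b) i j = ∏ k, (pauli (a k) * pauli (b k)) (i k) (j k) := by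
  simp only [Matrix.mul_apply, pauliString, Matrix.of_apply, ← Finset.prod_mul_distrib]
  rw [Finset.prod_univ_sum, Fintype.piFinset_univ]

lemma pauliString_mul_self (a : PauliLabel n) : pauliString a * pauliString a = 1 := by
  ext i j
  rw [pauliString_mul_apply]
  simp only [pauli_mul_self, Matrix.one_apply, Finset.prod_ite_zero]
  simp [funext_iff]

lemma trace_pauliString_mul (a b : PauliLabel n) :
    (pauliString a * pauliString b).trace = if a = b then 2 ^ n else 0 := by
  simp only [Matrix.trace, Matrix.diag, pauliString_mul_apply]
  rw [← Fintype.piFinset_univ, ← Finset.prod_univ_sum (fun _ => Finset.univ)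
    (fun k i => (pauli (a k) * pauli (b k)) i i)]
  have h (k : Fin n) : ∑ i, (pauli (a k) * pauli (b k)) i i = if a k = b k then 2 else 0 :=
    trace_pauli_mul (a k) (b k)
  simp only [h, Finset.prod_ite_zero]
  simp [funext_iff]

/-- The Pauli matrices form a tight frame, in entries. -/
lemma sum_pauliString_mul (i j k l : Fin n → Fin 2) :
    ∑ a : PauliLabel n, pauliString a i j * pauliString a l k =
      if i = k ∧ j = l then 2 ^ n else 0 := by
  simp only [pauliString, Matrix.of_apply, ← Finset.prod_mul_distrib]
  rw [← Fintype.piFinset_univ, ← Finset.prod_univ_sum (fun _ => Finset.univ)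
    (fun q a => pauli a (i q) (j q) * pauli a (l q) (k q))]
  simp only [sum_pauli_mul_pauli, Finset.prod_ite_zero]
  simp [funext_iff, forall_and]

/-- The expansion of a matrix in the Pauli basis. -/
lemma sum_trace_smul_pauliString (X : QMat n) :
    ∑ a, (X * pauliString a).trace • pauliString a = (2 ^ n : ℂ) • X := by
  ext k l
  simp only [Matrix.sum_apply, Matrix.smul_apply, smul_eq_mul, Matrix.trace, Matrix.diag,
    Matrix.mul_apply, Finset.sum_mul]
  rw [Finset.sum_comm]
  have h (i : Fin n → Fin 2) : ∑ a : PauliLabel n, ∑ j, X i j * pauliString a j i *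
      pauliString a k l = if i = k then 2 ^ n * X i l else 0 := by
    rw [Finset.sum_comm]
    simp only [mul_assoc, ← Finset.mul_sum]
    simp only [sum_pauliString_mul]
    by_cases hi : i = k <;> simp [hi, mul_comm, and_comm]
  simp [h]

lemma ofReal_re_trace_mul_pauliString {X : QMat n} (hX : X.IsHermitian) (a : PauliLabel n) :
    ((X * pauliString a).trace.re : ℂ) = (X * pauliString a).trace := by
  rw [← Complex.conj_eq_iff_re]
  change star _ = _
  rw [← Matrix.trace_conjTranspose, Matrix.conjTranspose_mul, hX.eq,
    (isHermitian_pauliString a).eq, Matrix.trace_mul_comm]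

lemma star_trace_mul_pauliString (X : QMat n) (a : PauliLabel n) :
    star (X * pauliString a).trace = (Xᴴ * pauliString a).trace := by
  rw [← Matrix.trace_conjTranspose, Matrix.conjTranspose_mul,
    (isHermitian_pauliString a).eq, Matrix.trace_mul_comm]

/-- Parseval's identity for the Pauli basis. -/
lemma sum_norm_trace_sq (X : QMat n) :
    ∑ a, ‖(X * pauliString a).trace‖ ^ 2 = 2 ^ n * frobSq X := by
  have h1 : (Xᴴ * ∑ a, (X * pauliString a).trace • pauliString a).trace =
      ((∑ a, ‖(X * pauliString a).trace‖ ^ 2 : ℝ) : ℂ) := by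
    rw [Finset.mul_sum, Matrix.trace_sum]
    push_cast
    refine Finset.sum_congr rfl fun a _ => ?_
    rw [mul_smul_comm, Matrix.trace_smul, ← star_trace_mul_pauliString, smul_eq_mul]
    exact Complex.mul_conj' _
  rw [sum_trace_smul_pauliString, mul_smul_comm, Matrix.trace_smul] at h1
  have h2 := congrArg Complex.re h1
  rw [Complex.ofReal_re] at h2
  rw [← h2, ← trace_conjTranspose_mul_re, smul_eq_mul,
    show (2 ^ n : ℂ) = ((2 ^ n : ℝ) : ℂ) by push_cast; rfl, Complex.re_ofReal_mul]

lemma norm_pauliString (a : PauliLabel n) : ‖pauliString a‖ = 1 := by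
  have h := CStarRing.norm_star_mul_self (x := pauliString a)
  rw [Matrix.star_eq_conjTranspose, (isHermitian_pauliString a).eq, pauliString_mul_self,
    CStarRing.norm_one] at h
  nlinarith [norm_nonneg (pauliString a)]

lemma card_pauliLabel : Fintype.card (PauliLabel n) = (2 ^ n) ^ 2 := by
  rw [← pow_mul, mul_comm, pow_mul]
  simp

lemma half_le_log_two_pow (hn : 1 ≤ n) : 1 / 2 ≤ Real.log (2 ^ n) := by
  have h1 : Real.log 2 ≤ Real.log (2 ^ n) :=
    Real.log_le_log two_pos (by
      calc (2 : ℝ) = 2 ^ 1 := (pow_one 2).symm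
        _ ≤ 2 ^ n := pow_le_pow_right₀ one_le_two hn)
  linarith [Real.log_two_gt_d9]

lemma trace_pauliString_mul_sampling {m : ℕ} (A : Fin m ↪ PauliLabel n) (X : QMat n) (j : Fin m) :
    (pauliString (A j) * sampling A X).trace =
      ((2 ^ n) ^ 2 / m : ℂ) * (pauliString (A j) * X).trace := by
  simp only [sampling, mul_smul_comm, Matrix.trace_smul, Finset.mul_sum, Matrix.trace_sum,
    trace_pauliString_mul, A.injective.eq_iff, smul_eq_mul]
  simp [Matrix.trace_mul_comm X]
  ring

/-- On the span of the sampled Pauli matrices the sampling operator is a multiple of the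
identity. -/
lemma trace_mul_sampling {m : ℕ} (A : Fin m ↪ PauliLabel n) (X : QMat n) {Y : QMat n}
    (hY : Y ∈ Submodule.span ℂ (pauliString '' Set.range A)) :
    (Y * sampling A X).trace = ((2 ^ n) ^ 2 / m : ℂ) * (Y * X).trace := by
  induction hY using Submodule.span_induction with
  | mem Y hY =>
    obtain ⟨_, ⟨j, rfl⟩, rfl⟩ := hY
    exact trace_pauliString_mul_sampling A X j
  | zero => simp
  | add Y Z _ _ hY hZ => simp [add_mul, hY, hZ, mul_add]
  | smul c Y _ hY => simp [hY]; ring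

/-- The Pauli matrices drawn are orthogonal, as the draw is injective. -/
lemma frobSq_sampling {m : ℕ} (A : Fin m ↪ PauliLabel n) (X : QMat n) :
    frobSq (sampling A X) =
      (2 ^ n) ^ 3 / m ^ 2 * ∑ j, ‖(X * pauliString (A j)).trace‖ ^ 2 := by
  have h1 : ((sampling A X)ᴴ * sampling A X).trace =
      (((2 ^ n) ^ 3 / m ^ 2 * ∑ j, ‖(X * pauliString (A j)).trace‖ ^ 2 : ℝ) : ℂ) := by
    have h2 : (sampling A X)ᴴ = ((2 : ℂ) ^ n / (m : ℂ)) •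
        ∑ i, star (X * pauliString (A i)).trace • pauliString (A i) := by
      simp [sampling, Matrix.conjTranspose_smul, Matrix.conjTranspose_sum,
        (isHermitian_pauliString _).eq]
    rw [h2, smul_mul_assoc, Matrix.trace_smul, Finset.sum_mul, Matrix.trace_sum]
    push_cast
    rw [Finset.mul_sum, smul_eq_mul, Finset.mul_sum]
    refine Finset.sum_congr rfl fun j _ => ?_
    rw [smul_mul_assoc, Matrix.trace_smul, trace_pauliString_mul_sampling, Matrix.trace_mul_comm X,
      smul_eq_mul, ← Complex.conj_mul']
    change _ = _ * (star _ * _)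
    ring
  rw [← trace_conjTranspose_mul_re, h1, Complex.ofReal_re]

/-- Bessel's inequality for the Pauli matrices that were drawn. -/
lemma sum_norm_trace_sq_le {m : ℕ} (A : Fin m ↪ PauliLabel n) (X : QMat n) :
    ∑ j, ‖(X * pauliString (A j)).trace‖ ^ 2 ≤ 2 ^ n * frobSq X := by
  rw [← sum_norm_trace_sq,
    ← Finset.sum_map Finset.univ A (fun a => ‖(X * pauliString a).trace‖ ^ 2)]
  exact Finset.sum_le_sum_of_subset_of_nonneg (Finset.subset_univ _) fun _ _ _ => by positivity

lemma sampling_sub {m : ℕ} (A : Fin m → PauliLabel n) (X Y : QMat n) :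
    sampling A (X - Y) = sampling A X - sampling A Y := by
  simp [sampling, sub_mul, sub_smul, smul_sub]

end Pauli
end QTomography

/-! ### Tangent spaces and the randomised Kaczmarz iteration -/

namespace QTomography

section Tangent

open scoped Matrix.Norms.L2Operator MatrixOrder

variable {D : Type*} [Fintype D] [DecidableEq D]

/-- The projection of `X` onto the tangent space `{X | (1 - P) X (1 - P) = 0}` of an orthogonal
projection `P`. -/
def tangentProj (P X : Matrix D D ℂ) : Matrix D D ℂ := X - (1 - P) * X * (1 - P)

lemma one_sub_mul_self {P : Matrix D D ℂ} (hPP : P * P = P) : (1 - P) * (1 - P) = 1 - P := by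
  simp [sub_mul, mul_sub, hPP]

lemma mul_one_sub {P : Matrix D D ℂ} (hPP : P * P = P) : P * (1 - P) = 0 := by
  simp [mul_sub, hPP]

lemma frobSq_proj_mul_add {P : Matrix D D ℂ} (hP : P.IsHermitian) (hPP : P * P = P)
    (X : Matrix D D ℂ) : frobSq (P * X) + frobSq ((1 - P) * X) = frobSq X := by
  have hQ : (1 - P).IsHermitian := Matrix.isHermitian_one.sub hP
  have e (R : Matrix D D ℂ) (h : R.IsHermitian) (h' : R * R = R) :
      (R * X)ᴴ * (R * X) = Xᴴ * R * X := by
    rw [Matrix.conjTranspose_mul, h.eq, mul_assoc, ← mul_assoc R, h', mul_assoc]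
  rw [← trace_conjTranspose_mul_re, ← trace_conjTranspose_mul_re, ← trace_conjTranspose_mul_re,
    e P hP hPP, e _ hQ (one_sub_mul_self hPP), ← Complex.add_re, ← Matrix.trace_add]
  simp [mul_sub, sub_mul]

lemma frobSq_proj_mul_le {P : Matrix D D ℂ} (hP : P.IsHermitian) (hPP : P * P = P)
    (X : Matrix D D ℂ) : frobSq (P * X) ≤ frobSq X := by
  linarith [frobSq_proj_mul_add hP hPP X, frobSq_nonneg ((1 - P) * X)]

lemma frobSq_one_sub_proj_mul_le {P : Matrix D D ℂ} (hP : P.IsHermitian) (hPP : P * P = P)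
    (X : Matrix D D ℂ) : frobSq ((1 - P) * X) ≤ frobSq X := by
  linarith [frobSq_proj_mul_add hP hPP X, frobSq_nonneg (P * X)]

lemma frobSq_mul_proj_le {P : Matrix D D ℂ} (hP : P.IsHermitian) (hPP : P * P = P)
    (X : Matrix D D ℂ) : frobSq (X * P) ≤ frobSq X := by
  rw [← frobSq_conjTranspose, Matrix.conjTranspose_mul, hP.eq, ← frobSq_conjTranspose X]
  exact frobSq_proj_mul_le hP hPP _

lemma proj_mul_tangentProj {P : Matrix D D ℂ} (hPP : P * P = P) (X : Matrix D D ℂ) :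
    P * tangentProj P X = P * X := by
  rw [tangentProj, mul_sub, mul_assoc, ← mul_assoc P, mul_one_sub hPP, zero_mul, sub_zero]

lemma one_sub_mul_tangentProj {P : Matrix D D ℂ} (hPP : P * P = P) (X : Matrix D D ℂ) :
    (1 - P) * tangentProj P X = (1 - P) * (X * P) := by
  rw [tangentProj, mul_sub, ← mul_assoc, ← mul_assoc, one_sub_mul_self hPP]
  noncomm_ring

lemma frobSq_tangentProj_le {P : Matrix D D ℂ} (hP : P.IsHermitian) (hPP : P * P = P)
    (X : Matrix D D ℂ) : frobSq (tangentProj P X) ≤ frobSq X := by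
  rw [← frobSq_proj_mul_add hP hPP, ← frobSq_proj_mul_add hP hPP X, proj_mul_tangentProj hPP,
    one_sub_mul_tangentProj hPP, ← mul_assoc]
  gcongr
  exact frobSq_mul_proj_le hP hPP _

/-- The incoherence of a Hermitian unitary `W` with the tangent space of a projection of low
rank. -/
lemma frobSq_tangentProj_le_two_mul_trace {P W : Matrix D D ℂ} (hP : P.IsHermitian)
    (hPP : P * P = P) (hW : W.IsHermitian) (hWW : W * W = 1) :
    frobSq (tangentProj P W) ≤ 2 * P.trace.re := by
  rw [← frobSq_proj_mul_add hP hPP, proj_mul_tangentProj hPP, one_sub_mul_tangentProj hPP]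
  have h1 : frobSq (P * W) = P.trace.re := by
    rw [← trace_mul_conjTranspose_re, Matrix.conjTranspose_mul, hP.eq, hW.eq, mul_assoc,
      ← mul_assoc W, hWW, one_mul, hPP]
  have h2 : frobSq (W * P) = P.trace.re := by
    rw [← h1, ← frobSq_conjTranspose, Matrix.conjTranspose_mul, hP.eq, hW.eq]
  linarith [frobSq_one_sub_proj_mul_le hP hPP (W * P)]

lemma isHermitian_conj_one_sub {P W : Matrix D D ℂ} (hP : P.IsHermitian) (hW : W.IsHermitian) :
    ((1 - P) * W * (1 - P)).IsHermitian := by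
  rw [Matrix.IsHermitian, Matrix.conjTranspose_mul, Matrix.conjTranspose_mul, hW.eq,
    (Matrix.isHermitian_one.sub hP).eq, mul_assoc]

lemma conj_one_sub_conj {P : Matrix D D ℂ} (hPP : P * P = P) (X : Matrix D D ℂ) :
    (1 - P) * ((1 - P) * X * (1 - P)) * (1 - P) = (1 - P) * X * (1 - P) := by
  have h := one_sub_mul_self hPP
  calc _ = ((1 - P) * (1 - P)) * X * ((1 - P) * (1 - P)) := by simp only [mul_assoc]
    _ = _ := by rw [h]

lemma conj_tangentProj {P : Matrix D D ℂ} (hPP : P * P = P) (X : Matrix D D ℂ) :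
    (1 - P) * tangentProj P X * (1 - P) = 0 := by
  have h (Q Y Z : Matrix D D ℂ) : Q * (Y - Z) * Q = Q * Y * Q - Q * Z * Q := by
    rw [mul_sub, sub_mul]
  rw [tangentProj, h, conj_one_sub_conj hPP, sub_self]

/-- The projection onto the tangent space is self-adjoint. -/
lemma trace_mul_tangentProj {P V : Matrix D D ℂ} (hV : (1 - P) * V * (1 - P) = 0)
    (X : Matrix D D ℂ) : (V * tangentProj P X).trace = (V * X).trace := by
  have h : (V * ((1 - P) * X * (1 - P))).trace = 0 := by
    rw [← mul_assoc, Matrix.trace_mul_comm, ← mul_assoc, ← mul_assoc, hV, zero_mul,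
      Matrix.trace_zero]
  rw [tangentProj, mul_sub, Matrix.trace_sub, h, sub_zero]

lemma frobSq_sub_smul {V T : Matrix D D ℂ} (hV : V.IsHermitian) (hT : T.IsHermitian) (s : ℝ) :
    frobSq (V - s • T) = frobSq V - 2 * s * (V * T).trace.re + s ^ 2 * frobSq T := by
  simp only [← trace_mul_conjTranspose_re, (hV.sub (isHermitian_smul_real hT s)).eq, hV.eq, hT.eq,
    sub_mul, mul_sub, smul_mul_assoc, mul_smul_comm, Matrix.trace_sub, Matrix.trace_smul,
    Complex.sub_re, Complex.smul_re, Matrix.trace_mul_comm T V, smul_eq_mul]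
  ring

lemma norm_le_one_of_proj {P : Matrix D D ℂ} (hP : P.IsHermitian) (hPP : P * P = P) :
    ‖P‖ ≤ 1 := by
  have h := CStarRing.norm_star_mul_self (x := P)
  rw [Matrix.star_eq_conjTranspose, hP.eq, hPP] at h
  nlinarith [norm_nonneg P]

lemma norm_conj_one_sub_le {P : Matrix D D ℂ} (hP : P.IsHermitian) (hPP : P * P = P)
    (W : Matrix D D ℂ) : ‖(1 - P) * W * (1 - P)‖ ≤ ‖W‖ := by
  have h := norm_le_one_of_proj (Matrix.isHermitian_one.sub hP) (one_sub_mul_self hPP)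
  calc _ ≤ ‖(1 - P) * W‖ * ‖1 - P‖ := norm_mul_le _ _
    _ ≤ ‖1 - P‖ * ‖W‖ * ‖1 - P‖ := by gcongr; exact norm_mul_le _ _
    _ ≤ 1 * ‖W‖ * 1 := by gcongr
    _ = ‖W‖ := by ring

lemma sq_le_one_of_norm_le_one {B : Matrix D D ℂ} (hB : B.IsHermitian) (h : ‖B‖ ≤ 1) :
    B ^ 2 ≤ 1 := by
  have h1 : ‖B ^ 2‖ ≤ 1 := by
    rw [pow_two]
    exact (norm_mul_le _ _).trans (mul_le_one₀ h (norm_nonneg _) h)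
  have h2 := IsSelfAdjoint.le_algebraMap_norm_self (a := B ^ 2) (hB.pow 2)
  rw [Algebra.algebraMap_eq_smul_one] at h2
  refine h2.trans ?_
  nth_rw 2 [← one_smul ℝ (1 : Matrix D D ℂ)]
  rw [Matrix.le_iff, ← sub_smul]
  exact Matrix.PosSemidef.one.smul (sub_nonneg.2 h1)

end Tangent

section Kaczmarz

open scoped Matrix.Norms.L2Operator MatrixOrder

variable {n : ℕ} {P : QMat n} {κ r : ℝ}

/-- One step of the randomised Kaczmarz iteration with label `a`.  The residual `s.1` moves along
the tangential part of the Pauli matrix `w a`, and `s.2` collects the normal parts of these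
moves. -/
noncomputable def kaczmarzStep (P : QMat n) (κ : ℝ) (a : PauliLabel n) (s : QMat n × QMat n) :
    QMat n × QMat n :=
  (s.1 - (κ * (s.1 * pauliString a).trace.re) • tangentProj P (pauliString a),
    s.2 + (κ * (s.1 * pauliString a).trace.re) • ((1 - P) * pauliString a * (1 - P)))

/-- The properties of the pair (residual, normal part) that persist along the Kaczmarz
iteration. -/
structure KaczmarzInv (P : QMat n) (r : ℝ) (s : QMat n × QMat n) : Prop where
  herm_fst : s.1.IsHermitian
  tangent : (1 - P) * s.1 * (1 - P) = 0
  herm_snd : s.2.IsHermitian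
  normal : (1 - P) * s.2 * (1 - P) = s.2
  frobSq_le : frobSq s.1 ≤ r

/-- The energy inequality of the Kaczmarz step, which holds for every label `a`. -/
lemma frobSq_kaczmarzStep_le (hP : P.IsHermitian) (hPP : P * P = P) (hr : P.trace.re ≤ r)
    (hκ : 0 ≤ κ) (hκr : 2 * r * κ ≤ 1) {s : QMat n × QMat n} (hs : KaczmarzInv P r s)
    (a : PauliLabel n) :
    frobSq (kaczmarzStep P κ a s).1 ≤
      frobSq s.1 - κ * (s.1 * pauliString a).trace.re ^ 2 := by
  have hT : (tangentProj P (pauliString a)).IsHermitian :=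
    (isHermitian_pauliString a).sub (isHermitian_conj_one_sub hP (isHermitian_pauliString a))
  have h1 := frobSq_tangentProj_le_two_mul_trace hP hPP (isHermitian_pauliString a)
    (pauliString_mul_self a)
  rw [kaczmarzStep, frobSq_sub_smul hs.herm_fst hT, trace_mul_tangentProj hs.tangent]
  set t := (s.1 * pauliString a).trace.re
  have h2 : κ * frobSq (tangentProj P (pauliString a)) ≤ 1 := by nlinarith
  nlinarith [mul_le_mul_of_nonneg_left h2 (mul_nonneg hκ (sq_nonneg t))]

lemma sq_trace_re_le (hP : P.IsHermitian) (hPP : P * P = P) (hr : P.trace.re ≤ r)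
    {s : QMat n × QMat n} (hs : KaczmarzInv P r s) (a : PauliLabel n) :
    (s.1 * pauliString a).trace.re ^ 2 ≤ 2 * r * frobSq s.1 := by
  have h1 := frobSq_tangentProj_le_two_mul_trace hP hPP (isHermitian_pauliString a)
    (pauliString_mul_self a)
  rw [← trace_mul_tangentProj hs.tangent]
  have h2 := norm_trace_mul_sq_le s.1 (tangentProj P (pauliString a))
  have h3 := Complex.abs_re_le_norm (s.1 * tangentProj P (pauliString a)).trace
  have h4 := pow_le_pow_left₀ (abs_nonneg _) h3 2
  rw [sq_abs] at h4
  nlinarith [frobSq_nonneg s.1]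

lemma KaczmarzInv.step (hP : P.IsHermitian) (hPP : P * P = P) (hr : P.trace.re ≤ r)
    (hκ : 0 ≤ κ) (hκr : 2 * r * κ ≤ 1) (a : PauliLabel n) (s : QMat n × QMat n)
    (hs : KaczmarzInv P r s) : KaczmarzInv P r (kaczmarzStep P κ a s) where
  herm_fst := hs.herm_fst.sub (isHermitian_smul_real ((isHermitian_pauliString a).sub
    (isHermitian_conj_one_sub hP (isHermitian_pauliString a))) _)
  tangent := by
    have h (Q Y Z : QMat n) : Q * (Y - Z) * Q = Q * Y * Q - Q * Z * Q := by
      rw [mul_sub, sub_mul]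
    simp only [kaczmarzStep]
    rw [h, hs.tangent, mul_smul_comm, smul_mul_assoc, conj_tangentProj hPP, smul_zero, sub_zero]
  herm_snd := hs.herm_snd.add (isHermitian_smul_real
    (isHermitian_conj_one_sub hP (isHermitian_pauliString a)) _)
  normal := by
    simp only [kaczmarzStep]
    rw [mul_add, add_mul, hs.normal, mul_smul_comm, smul_mul_assoc, conj_one_sub_conj hPP]
  frobSq_le := (frobSq_kaczmarzStep_le hP hPP hr hκ hκr hs a).trans
    (by nlinarith [hs.frobSq_le, mul_nonneg hκ (sq_nonneg (s.1 * pauliString a).trace.re)])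

lemma sum_sq_trace_re {V : QMat n} (hV : V.IsHermitian) :
    ∑ a, (V * pauliString a).trace.re ^ 2 = 2 ^ n * frobSq V := by
  rw [← sum_norm_trace_sq]
  refine Finset.sum_congr rfl fun a _ => ?_
  rw [← ofReal_re_trace_mul_pauliString hV a, Complex.norm_real, Complex.ofReal_re,
    Real.norm_eq_abs, sq_abs]

/-- High moments of the residual decrease geometrically on average. -/
lemma sum_frobSq_kaczmarzStep_pow_le (hP : P.IsHermitian) (hPP : P * P = P)
    (hr : P.trace.re ≤ r) (hκ : 0 ≤ κ) {p : ℕ} (hp : p ≠ 0) (hκr : p * (2 * r * κ) ≤ 1)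
    {s : QMat n × QMat n} (hs : KaczmarzInv P r s) :
    ∑ a, frobSq (kaczmarzStep P κ a s).1 ^ p ≤ Fintype.card (PauliLabel n) *
      (Real.exp (-(p * κ / (2 * 2 ^ n))) * frobSq s.1 ^ p) := by
  have hF0 := frobSq_nonneg s.1
  have hr0 : 0 ≤ r := hF0.trans hs.frobSq_le
  have hp1 : (1 : ℝ) ≤ p := by exact_mod_cast Nat.one_le_iff_ne_zero.2 hp
  have hκr' : 2 * r * κ ≤ 1 := by
    have h0 : 0 ≤ 2 * r * κ := by positivity
    nlinarith
  have h1 (a : PauliLabel n) : frobSq (kaczmarzStep P κ a s).1 ^ p ≤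
      frobSq s.1 ^ p - p * κ / 2 * frobSq s.1 ^ (p - 1) * (s.1 * pauliString a).trace.re ^ 2 := by
    have h2 := frobSq_kaczmarzStep_le hP hPP hr hκ hκr' hs a
    have h3 := sq_trace_re_le hP hPP hr hs a
    set t := (s.1 * pauliString a).trace.re
    set F := frobSq s.1
    rcases hF0.eq_or_lt with h0 | h0
    · have ht : t ^ 2 = 0 := by nlinarith [sq_nonneg t]
      have h4 : frobSq (kaczmarzStep P κ a s).1 = 0 :=
        le_antisymm (by rw [ht] at h2; linarith) (frobSq_nonneg _)
      rw [h4, ht, ← h0]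
      simp
    · set y := κ * t ^ 2 / F with hy
      have hy0 : 0 ≤ y := by positivity
      have hpy : p * y ≤ 1 := by
        refine le_trans ?_ hκr
        rw [hy]
        gcongr
        rw [div_le_iff₀ h0]
        nlinarith
      have hFy : κ * t ^ 2 = F * y := by rw [hy]; field_simp
      -- on `p * y ∈ [0, 1]` the exponential stays below a line of half its slope at zero
      have hexp : Real.exp (-(p * y)) ≤ 1 - p * y / 2 := by
        have h5 := Real.add_one_le_exp (p * y)
        have h6 : 0 ≤ p * y := by positivity
        rw [Real.exp_neg, inv_le_iff_one_le_mul₀ (Real.exp_pos _)]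
        nlinarith
      calc frobSq (kaczmarzStep P κ a s).1 ^ p ≤ (F * Real.exp (-y)) ^ p := by
            refine pow_le_pow_left₀ (frobSq_nonneg _) (h2.trans ?_) p
            rw [hFy]
            nlinarith [Real.add_one_le_exp (-y)]
        _ = F ^ p * Real.exp (-(p * y)) := by
            rw [mul_pow, ← Real.exp_nat_mul]; ring_nf
        _ ≤ F ^ p * (1 - p * y / 2) := by gcongr
        _ = F ^ p - p / 2 * F ^ (p - 1) * (F * y) := by
            obtain ⟨q, rfl⟩ := Nat.exists_eq_succ_of_ne_zero hp
            simp only [Nat.succ_eq_add_one, Nat.add_sub_cancel, pow_succ]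
            ring
        _ = _ := by rw [← hFy]; ring
  refine (Finset.sum_le_sum fun a _ => h1 a).trans ?_
  rw [Finset.sum_sub_distrib, ← Finset.mul_sum, sum_sq_trace_re hs.herm_fst]
  simp only [Finset.sum_const, Finset.card_univ, nsmul_eq_mul, card_pauliLabel]
  obtain ⟨q, rfl⟩ := Nat.exists_eq_succ_of_ne_zero hp
  simp only [Nat.succ_eq_add_one, Nat.add_sub_cancel, pow_succ (frobSq s.1)]
  have h8 := Real.add_one_le_exp (-(((q + 1 : ℕ) : ℝ) * κ / (2 * 2 ^ n)))
  have h9 : 0 ≤ ((2 ^ n) ^ 2 : ℝ) * (frobSq s.1 ^ q * frobSq s.1) := by positivity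
  calc _ = ((2 ^ n) ^ 2 : ℝ) * (frobSq s.1 ^ q * frobSq s.1) *
        (-(((q + 1 : ℕ) : ℝ) * κ / (2 * 2 ^ n)) + 1) := by
        push_cast
        field_simp
        ring
    _ ≤ _ := mul_le_mul_of_nonneg_left h8 h9
    _ = _ := by push_cast; ring

/-- The potential `exp (θ² κ ‖V‖²) * tr exp (θ S)` does not grow on average: by the energy
inequality its first factor compensates the quadratic variation of `S`. -/
lemma sum_potential_kaczmarzStep_le (hP : P.IsHermitian) (hPP : P * P = P)
    (hr : P.trace.re ≤ r) (hκ : 0 ≤ κ) (hκr : 2 * r * κ ≤ 1) {θ : ℝ}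
    (hθ : 8 * (θ * κ * r) ^ 2 ≤ 1) {s : QMat n × QMat n} (hs : KaczmarzInv P r s) :
    ∑ a, Real.exp (θ ^ 2 * κ * frobSq (kaczmarzStep P κ a s).1) *
        (NormedSpace.exp (θ • (kaczmarzStep P κ a s).2)).trace.re ≤
      Fintype.card (PauliLabel n) * (1 * (Real.exp (θ ^ 2 * κ * frobSq s.1) *
        (NormedSpace.exp (θ • s.2)).trace.re)) := by
  set t : PauliLabel n → ℝ := fun a => (s.1 * pauliString a).trace.re with ht
  set B : PauliLabel n → QMat n := fun a => (1 - P) * pauliString a * (1 - P) with hB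
  set q : PauliLabel n → ℝ := fun a => (θ * κ * t a) ^ 2 with hq
  have hBh (a : PauliLabel n) : (B a).IsHermitian :=
    isHermitian_conj_one_sub hP (isHermitian_pauliString a)
  have hxh (a : PauliLabel n) : ((θ * κ * t a) • B a).IsHermitian :=
    isHermitian_smul_real (hBh a) _
  have hr0 : 0 ≤ r := (frobSq_nonneg _).trans hs.frobSq_le
  have hq4 (a : PauliLabel n) : q a ≤ 1 / 4 := by
    have h1 := sq_trace_re_le hP hPP hr hs a
    have h2 : t a ^ 2 ≤ 2 * r ^ 2 := by nlinarith [hs.frobSq_le]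
    have h3 : (θ * κ) ^ 2 * t a ^ 2 ≤ (θ * κ) ^ 2 * (2 * r ^ 2) := by gcongr
    simp only [hq]
    nlinarith
  have hxsq (a : PauliLabel n) : ((θ * κ * t a) • B a) ^ 2 ≤ q a • (1 : QMat n) := by
    rw [smul_pow, Matrix.le_iff, ← smul_sub]
    refine (Matrix.le_iff.1 (sq_le_one_of_norm_le_one (hBh a) ?_)).smul (sq_nonneg _)
    exact (norm_conj_one_sub_le hP hPP _).trans (norm_pauliString a).le
  have hsum : ∑ a, (θ * κ * t a) • B a = 0 := by
    have h1 : ∑ a, t a • pauliString a = (2 ^ n : ℂ) • s.1 := by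
      rw [← sum_trace_smul_pauliString]
      refine Finset.sum_congr rfl fun a _ => ?_
      rw [← ofReal_re_trace_mul_pauliString hs.herm_fst a]
      simp [ht]
    have h2 : ∑ a, (θ * κ * t a) • B a =
        (θ * κ) • ((1 - P) * (∑ a, t a • pauliString a) * (1 - P)) := by
      simp only [Finset.mul_sum, Finset.sum_mul, Finset.smul_sum, mul_smul_comm, smul_mul_assoc,
        smul_smul, hB]
    rw [h2, h1, mul_smul_comm, smul_mul_assoc, hs.tangent, smul_zero, smul_zero]
  have hexp : ∑ a, Real.exp (-q a) • NormedSpace.exp ((θ * κ * t a) • B a) ≤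
      (Fintype.card (PauliLabel n) : ℝ) • (1 : QMat n) := by
    calc _ ≤ ∑ a, ((1 : QMat n) + (θ * κ * t a) • B a) := by
          refine Finset.sum_le_sum fun a _ => ?_
          have h1 := exp_le_exp_smul_one_add (hxh a) (hxsq a) (hq4 a)
          have h2 := (Matrix.le_iff.1 h1).smul (Real.exp_pos (-q a)).le
          rw [smul_sub, smul_smul, ← Real.exp_add, neg_add_cancel, Real.exp_zero, one_smul] at h2
          exact Matrix.le_iff.2 h2
      _ = _ := by
          rw [Finset.sum_add_distrib, hsum, add_zero, Finset.sum_const, Finset.card_univ,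
            ← Nat.cast_smul_eq_nsmul ℝ]
  have h1 := sum_mul_trace_exp_add_le (isHermitian_smul_real hs.herm_snd θ) hxh
    (fun a => (Real.exp_pos (-q a)).le) hexp
  rw [one_mul, mul_left_comm]
  refine le_trans ?_ (mul_le_mul_of_nonneg_left h1 (Real.exp_pos _).le)
  rw [Finset.mul_sum]
  refine Finset.sum_le_sum fun a _ => ?_
  have e1 : θ • (kaczmarzStep P κ a s).2 = θ • s.2 + (θ * κ * t a) • B a := by
    simp only [kaczmarzStep, smul_add, smul_smul, ht, hB, mul_assoc]
  rw [e1, ← mul_assoc, ← Real.exp_add]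
  gcongr
  · rw [trace_exp_eq ((isHermitian_smul_real hs.herm_snd θ).add (hxh a))]
    exact Finset.sum_nonneg fun k _ => (Real.exp_pos _).le
  · have h2 := frobSq_kaczmarzStep_le hP hPP hr hκ hκr hs a
    have h3 : θ ^ 2 * κ * frobSq (kaczmarzStep P κ a s).1 ≤
        θ ^ 2 * κ * (frobSq s.1 - κ * t a ^ 2) := by gcongr
    simp only [hq]
    linarith

end Kaczmarz
end QTomography

/-! ### Existence of a certificate -/

namespace QTomography

section Certificate

open scoped Matrix.Norms.L2Operator MatrixOrder

variable {n : ℕ} {P : QMat n} {κ r : ℝ}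

/-- An approximate dual certificate for the projection `P` in the span of the Pauli matrices with
labels in `Ω`: a matrix `P - V + S` whose tangential error `V` is small in Frobenius norm and
whose normal part `S` has operator norm at most `1 / 2`. -/
def HasCertificate (P : QMat n) (τ : ℝ) (Ω : Set (PauliLabel n)) : Prop :=
  ∃ V S : QMat n, (1 - P) * V * (1 - P) = 0 ∧ frobSq V ≤ τ ∧ (1 - P) * S * (1 - P) = S ∧
    ‖S‖ ≤ 1 / 2 ∧ P - V + S ∈ Submodule.span ℂ (pauliString '' Ω)

lemma HasCertificate.mono {τ : ℝ} {Ω Ω' : Set (PauliLabel n)} (h : Ω ⊆ Ω')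
    (hΩ : HasCertificate P τ Ω) : HasCertificate P τ Ω' := by
  obtain ⟨V, S, h1, h2, h3, h4, h5⟩ := hΩ
  exact ⟨V, S, h1, h2, h3, h4, Submodule.span_mono (Set.image_mono h) h5⟩

/-- The normal part minus the residual changes along the Kaczmarz iteration only by combinations
of the Pauli matrices that were drawn. -/
lemma iterSteps_kaczmarzStep_mem_span {k : ℕ} (s : QMat n × QMat n) (f : Fin k → PauliLabel n) :
    (iterSteps (kaczmarzStep P κ) k s f).2 - (iterSteps (kaczmarzStep P κ) k s f).1 -
      (s.2 - s.1) ∈ Submodule.span ℂ (pauliString '' Set.range f) := by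
  induction k generalizing s with
  | zero => simp [iterSteps]
  | succ k ih =>
    rw [iterSteps]
    have h1 := ih (kaczmarzStep P κ (f 0) s) (Fin.tail f)
    have h2 : Set.range (Fin.tail f) ⊆ Set.range f := by
      rintro _ ⟨j, rfl⟩
      exact ⟨j.succ, rfl⟩
    have h3 := Submodule.span_mono (R := ℂ) (Set.image_mono (f := pauliString) h2) h1
    have h4 : (kaczmarzStep P κ (f 0) s).2 - (kaczmarzStep P κ (f 0) s).1 - (s.2 - s.1) =
        ((κ * (s.1 * pauliString (f 0)).trace.re : ℝ) : ℂ) • pauliString (f 0) := by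
      simp only [kaczmarzStep, tangentProj, smul_sub, Complex.coe_smul]
      abel
    have h5 : ((κ * (s.1 * pauliString (f 0)).trace.re : ℝ) : ℂ) • pauliString (f 0) ∈
        Submodule.span ℂ (pauliString '' Set.range f) :=
      Submodule.smul_mem _ _ (Submodule.subset_span ⟨f 0, ⟨0, rfl⟩, rfl⟩)
    rw [← h4] at h5
    have h6 := Submodule.add_mem _ h3 h5
    convert h6 using 1
    abel

lemma frobSq_proj (hP : P.IsHermitian) (hPP : P * P = P) : frobSq P = P.trace.re := by
  rw [← trace_mul_conjTranspose_re, hP.eq, hPP]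

/-- A run of `m` independent Kaczmarz steps from `(P, 0)` yields a certificate, except when the
residual is large, by the bound on its `p`-th moment, or when the normal part is large, by the bound
on the trace exponentials of `θ S` and `-θ S`. -/
lemma uniformProb_not_hasCertificate_le (hP : P.IsHermitian) (hPP : P * P = P)
    (hr : P.trace.re ≤ r) (hκ : 0 ≤ κ) {p : ℕ} (hp : p ≠ 0) (hκr : p * (2 * r * κ) ≤ 1)
    {θ : ℝ} (hθ0 : 0 < θ) (hθ : 8 * (θ * κ * r) ^ 2 ≤ 1) {τ : ℝ} (hτ : 0 < τ) (m : ℕ) :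
    uniformProb (fun f : Fin m → PauliLabel n => ¬ HasCertificate P τ (Set.range f)) ≤
      Real.exp (-(p * κ / (2 * 2 ^ n))) ^ m * r ^ p / τ ^ p +
        2 * (2 ^ n * Real.exp (θ ^ 2 * κ * r) / Real.exp (θ / 2)) := by
  have hPr : frobSq P ≤ r := (frobSq_proj hP hPP).trans_le hr
  have hr0 : 0 ≤ r := (frobSq_nonneg P).trans hPr
  have hp1 : (1 : ℝ) ≤ p := by exact_mod_cast Nat.one_le_iff_ne_zero.2 hp
  have hκr' : 2 * r * κ ≤ 1 := by
    have h0 : 0 ≤ 2 * r * κ := by positivity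
    nlinarith
  have hs0 : KaczmarzInv P r (P, 0) :=
    ⟨hP, by rw [mul_assoc, mul_one_sub hPP, mul_zero], Matrix.isHermitian_zero, by simp, hPr⟩
  have hstep := fun a s => KaczmarzInv.step (n := n) hP hPP hr hκ hκr' a s
  set run : (Fin m → PauliLabel n) → QMat n × QMat n :=
    iterSteps (kaczmarzStep P κ) m (P, 0) with hrun
  have hinv (f : Fin m → PauliLabel n) : KaczmarzInv P r (run f) :=
    iterSteps_induction (I := KaczmarzInv P r) hstep hs0 f
  have hE1 : uniformProb (fun f => τ < frobSq (run f).1) ≤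
      Real.exp (-(p * κ / (2 * 2 ^ n))) ^ m * r ^ p / τ ^ p := by
    refine uniformProb_le_div (f := fun f => frobSq (run f).1 ^ p) (by positivity)
      (fun f => pow_nonneg (frobSq_nonneg _) p)
      (fun f hf => pow_le_pow_left₀ hτ.le hf.le p) ?_ (by positivity)
    refine (sum_iterSteps_le (I := KaczmarzInv P r) (Φ := fun s => frobSq s.1 ^ p) hstep
      (Real.exp_pos _).le
      (fun s hs => sum_frobSq_kaczmarzStep_pow_le hP hPP hr hκ hp hκr hs) hs0).trans ?_
    have := pow_le_pow_left₀ (frobSq_nonneg P) hPr p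
    gcongr
  have hE2 (η : ℝ) (hη : η ^ 2 = θ ^ 2) :
      uniformProb (fun f => Real.exp (θ / 2) < (NormedSpace.exp (η • (run f).2)).trace.re) ≤
        2 ^ n * Real.exp (θ ^ 2 * κ * r) / Real.exp (θ / 2) := by
    have hη' : 8 * (η * κ * r) ^ 2 ≤ 1 := by
      rw [mul_assoc, mul_pow, hη, ← mul_pow, ← mul_assoc]; exact hθ
    have hpos (f : Fin m → PauliLabel n) : 0 ≤ (NormedSpace.exp (η • (run f).2)).trace.re := by
      rw [trace_exp_eq (isHermitian_smul_real (hinv f).herm_snd η)]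
      exact Finset.sum_nonneg fun k _ => (Real.exp_pos _).le
    have hge (f : Fin m → PauliLabel n) : 1 ≤ Real.exp (η ^ 2 * κ * frobSq (run f).1) :=
      Real.one_le_exp (mul_nonneg (by positivity) (frobSq_nonneg _))
    refine uniformProb_le_div (f := fun f => Real.exp (η ^ 2 * κ * frobSq (run f).1) *
      (NormedSpace.exp (η • (run f).2)).trace.re) (Real.exp_pos _)
      (fun f => mul_nonneg (Real.exp_pos _).le (hpos f))
      (fun f hf => hf.le.trans (le_mul_of_one_le_left (hpos f) (hge f))) ?_ (by positivity)
    refine (sum_iterSteps_le (I := KaczmarzInv P r) (Φ := fun s =>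
      Real.exp (η ^ 2 * κ * frobSq s.1) * (NormedSpace.exp (η • s.2)).trace.re) hstep
      zero_le_one
      (fun s hs => sum_potential_kaczmarzStep_le hP hPP hr hκ hκr' hη' hs) hs0).trans ?_
    have e1 : (NormedSpace.exp (η • (0 : QMat n))).trace.re = 2 ^ n := by
      rw [smul_zero, NormedSpace.exp_zero, Matrix.trace_one,
        ← Complex.ofReal_natCast, Complex.ofReal_re]
      simp
    simp only [e1, hη, one_pow, one_mul]
    rw [mul_comm (Real.exp _)]
    gcongr
  have hall (f : Fin m → PauliLabel n) (hf : ¬ HasCertificate P τ (Set.range f)) :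
      τ < frobSq (run f).1 ∨
        (Real.exp (θ / 2) < (NormedSpace.exp (θ • (run f).2)).trace.re ∨
          Real.exp (θ / 2) < (NormedSpace.exp ((-θ) • (run f).2)).trace.re) := by
    by_contra! hcon
    obtain ⟨h1, h2, h3⟩ := hcon
    refine hf ⟨(run f).1, (run f).2, (hinv f).tangent, h1, (hinv f).normal, ?_, ?_⟩
    · have hh := isHermitian_smul_real (hinv f).herm_snd θ
      have hh' := isHermitian_smul_real (hinv f).herm_snd (-θ)
      have h4 := le_smul_one_of_trace_exp_le hh h2
      have h5 := le_smul_one_of_trace_exp_le hh' h3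
      rw [neg_smul] at h5
      have h6 := norm_le_of_le_of_neg_le hh (by positivity) h4 h5
      rw [norm_smul, Real.norm_of_nonneg hθ0.le] at h6
      nlinarith
    · have h7 := iterSteps_kaczmarzStep_mem_span (P := P) (κ := κ) (P, 0) f
      convert h7 using 1
      simp only [hrun]
      abel
  refine (uniformProb_le_add hall).trans (add_le_add hE1 ?_)
  rw [two_mul]
  exact (uniformProb_le_add fun f hf => hf).trans (add_le_add (hE2 θ rfl) (hE2 (-θ) (by ring)))

/-- With `m = c d r (log d) ^ 2` samples a certificate exists except with probability exponentially
small in `c`. -/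
lemma drawProb_not_hasCertificate_le (hP : P.IsHermitian) (hPP : P * P = P)
    {c : ℝ} (hc : 256 ≤ c) (hn : 1 ≤ n) (hr1 : 1 ≤ r) (hr : P.trace.re ≤ r) {m : ℕ}
    (hm : m ≤ (2 ^ n) ^ 2) (hmc : (m : ℝ) = c * 2 ^ n * r * (Real.log (2 ^ n)) ^ 2) :
    drawProb n m (fun A => ¬ HasCertificate P (r / 2 ^ n) (Set.range A)) ≤
      3 * Real.exp (-(1 / 256 * c)) := by
  rw [drawProb_eq_uniformProb]
  refine (uniformProb_embedding_le_uniformProb_fun (P := fun Ω => ¬ HasCertificate P (r / 2 ^ n) Ω)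
    (by rw [card_pauliLabel]; exact hm) fun s t hst h hs => h (hs.mono hst)).trans ?_
  set d : ℝ := 2 ^ n with hd
  set L := Real.log d with hL
  have hd0 : 0 < d := by positivity
  have hexpL : Real.exp L = d := Real.exp_log hd0
  have hL2 : 1 / 2 ≤ L := half_le_log_two_pow hn
  have hm0 : (0 : ℝ) < m := by rw [hmc]; positivity
  have hcL : 128 ≤ c * L := by nlinarith
  -- The step size is `κ = 4 d L / m`, so that `m` steps reduce the `p`-th moment of the residual by
  -- the factor `d ^ (-2 p)`. The largest moment it admits is `p ≈ c L / 8`.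
  set p : ℕ := ⌊c * L / 8⌋₊ with hp
  have hple : (p : ℝ) ≤ c * L / 8 := Nat.floor_le (by positivity)
  have hpge : c * L / 16 ≤ p := by
    have := (Nat.lt_floor_add_one (c * L / 8)).le
    rw [← hp] at this
    linarith
  have hp0 : p ≠ 0 := by
    rintro h
    rw [h] at hpge
    norm_num at hpge
    linarith
  have hκ : 4 * d * L / m = 4 / (c * r * L) := by
    rw [hmc]; field_simp
  have h := uniformProb_not_hasCertificate_le (κ := 4 * d * L / m) hP hPP hr (by positivity) hp0 (by
      rw [hκ]
      have e : (p : ℝ) * (2 * r * (4 / (c * r * L))) = p / (c * L / 8) := by field_simp; norm_num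
      rw [e, div_le_one (by positivity)]
      exact hple) (θ := c * L / 16) (by positivity) (by
      rw [hκ]
      have e : c * L / 16 * (4 / (c * r * L)) * r = 1 / 4 := by field_simp; norm_num
      rw [e]
      norm_num) (τ := r / d) (by positivity) m
  refine h.trans ?_
  have e1 : Real.exp (-(p * (4 * d * L / m) / (2 * d))) ^ m * r ^ p / (r / d) ^ p =
      Real.exp (-(p * L)) := by
    rw [div_pow, div_div_eq_mul_div, mul_right_comm, mul_div_assoc, div_self (by positivity),
      mul_one, ← Real.exp_nat_mul, ← hexpL, ← Real.exp_nat_mul, ← Real.exp_add, hexpL]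
    congr 1
    field_simp
    ring
  have e2 : d * Real.exp ((c * L / 16) ^ 2 * (4 * d * L / m) * r) / Real.exp (c * L / 16 / 2) =
      Real.exp (L - c * L / 64) := by
    rw [hκ, mul_div_assoc, ← Real.exp_sub]
    nth_rw 1 [← hexpL]
    rw [← Real.exp_add]
    congr 1
    field_simp
    ring
  rw [e1, e2]
  have h1 : Real.exp (-(p * L)) ≤ Real.exp (-(1 / 256 * c)) := by
    refine Real.exp_le_exp.2 (neg_le_neg ?_)
    have : c * L / 16 * L ≤ p * L := by gcongr
    nlinarith [mul_le_mul hL2 hL2 (by norm_num) (by linarith)]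
  have h2 : Real.exp (L - c * L / 64) ≤ Real.exp (-(1 / 256 * c)) := by
    refine Real.exp_le_exp.2 ?_
    nlinarith
  linarith

end Certificate
end QTomography

/-! ### The trace norm -/

namespace QTomography

section TraceNorm

open scoped Matrix.Norms.L2Operator MatrixOrder

variable {D : Type*} [Fintype D] [DecidableEq D]

lemma conjTranspose_mul_self_le (W : Matrix D D ℂ) : Wᴴ * W ≤ (‖W‖ ^ 2) • (1 : Matrix D D ℂ) := by
  have h := IsSelfAdjoint.le_algebraMap_norm_self (a := Wᴴ * W)
    (Matrix.isHermitian_conjTranspose_mul_self W)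
  rwa [Algebra.algebraMap_eq_smul_one, Matrix.l2_opNorm_conjTranspose_mul_self, ← pow_two] at h

lemma conj_conjTranspose_mul_self_le (W X : Matrix D D ℂ) :
    Xᴴ * (Wᴴ * W) * X ≤ (‖W‖ ^ 2) • (Xᴴ * X) := by
  have h := (Matrix.le_iff.1 (conjTranspose_mul_self_le W)).conjTranspose_mul_mul_same X
  rw [mul_sub, sub_mul, mul_smul_comm, mul_one, smul_mul_assoc] at h
  exact Matrix.le_iff.2 h

lemma frobSq_mul_le (W X : Matrix D D ℂ) : frobSq (W * X) ≤ ‖W‖ ^ 2 * frobSq X := by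
  have h := trace_mul_re_le Matrix.PosSemidef.one (conj_conjTranspose_mul_self_le W X)
  rw [one_mul, one_mul, Matrix.trace_smul, Complex.smul_re, trace_conjTranspose_mul_re,
    smul_eq_mul] at h
  rw [← trace_conjTranspose_mul_re, Matrix.conjTranspose_mul]
  simpa [mul_assoc] using h

lemma sqrt_frobSq_mul_le {W : Matrix D D ℂ} (hW : ‖W‖ ≤ 1) (X : Matrix D D ℂ) :
    √(frobSq (W * X)) ≤ √(frobSq X) := by
  refine Real.sqrt_le_sqrt ((frobSq_mul_le W X).trans ?_)
  exact mul_le_of_le_one_left (frobSq_nonneg X) (pow_le_one₀ (norm_nonneg _) hW)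

lemma sqrt_frobSq_add_le (X Y : Matrix D D ℂ) :
    √(frobSq (X + Y)) ≤ √(frobSq X) + √(frobSq Y) := by
  have hX := frobSq_nonneg X
  have hY := frobSq_nonneg Y
  refine Real.sqrt_le_iff.2 ⟨by positivity, ?_⟩
  have h1 : frobSq (X + Y) = frobSq X + 2 * (Xᴴ * Y).trace.re + frobSq Y := by
    have h2 : (Yᴴ * X).trace.re = (Xᴴ * Y).trace.re := by
      rw [← Complex.conj_re (Xᴴ * Y).trace]
      change _ = (star (Xᴴ * Y).trace).re
      rw [← Matrix.trace_conjTranspose, Matrix.conjTranspose_mul,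
        Matrix.conjTranspose_conjTranspose]
    rw [← trace_conjTranspose_mul_re, ← trace_conjTranspose_mul_re X,
      ← trace_conjTranspose_mul_re Y, Matrix.conjTranspose_add, add_mul, mul_add, mul_add]
    simp only [Matrix.trace_add, Complex.add_re, h2]
    ring
  have h3 := norm_trace_mul_le Xᴴ Y
  rw [frobSq_conjTranspose] at h3
  have h4 := Complex.re_le_norm (Xᴴ * Y).trace
  nlinarith [Real.sq_sqrt hX, Real.sq_sqrt hY]

lemma cfc_mul_cfc {H : Matrix D D ℂ} (hH : H.IsHermitian) (f g : ℝ → ℝ) :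
    hH.cfc f * hH.cfc g = hH.cfc (fun x => f x * g x) := by
  rw [Matrix.IsHermitian.cfc, Matrix.IsHermitian.cfc, Matrix.IsHermitian.cfc, ← map_mul,
    Matrix.diagonal_mul_diagonal]
  congr 2
  ext i
  simp

lemma isHermitian_cfc {H : Matrix D D ℂ} (hH : H.IsHermitian) (f : ℝ → ℝ) :
    (hH.cfc f).IsHermitian := by
  rw [← hH.cfc_eq]
  exact cfc_predicate f H

lemma trace_cfc {H : Matrix D D ℂ} (hH : H.IsHermitian) (f : ℝ → ℝ) :
    (hH.cfc f).trace = ((∑ k, f (hH.eigenvalues k) : ℝ) : ℂ) := by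
  rw [← sum_eigenDiag hH]
  simp [eigenDiag_cfc]

lemma norm_cfc_le_one {H : Matrix D D ℂ} (hH : H.IsHermitian) {f : ℝ → ℝ}
    (hf : ∀ x, |f x| ≤ 1) : ‖hH.cfc f‖ ≤ 1 := by
  rw [Matrix.IsHermitian.cfc, Unitary.conjStarAlgAut_apply, ← Unitary.coe_star,
    CStarRing.norm_mul_coe_unitary, CStarRing.norm_coe_unitary_mul, Matrix.l2_opNorm_diagonal]
  refine (pi_norm_le_iff_of_nonneg zero_le_one).2 fun k => ?_
  simpa using hf _

lemma cfc_mul_self {H : Matrix D D ℂ} (hH : H.IsHermitian) (f : ℝ → ℝ) :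
    hH.cfc f * H = hH.cfc (fun x => f x * x) :=
  (congrArg (hH.cfc f * ·) (eq_cfc_id hH)).trans (cfc_mul_cfc hH f id)

/-- The orthogonal projection onto the range of a Hermitian matrix. -/
lemma exists_range_projection {H : Matrix D D ℂ} (hH : H.IsHermitian) :
    ∃ P : Matrix D D ℂ, P.IsHermitian ∧ P * P = P ∧ P.trace.re = H.rank ∧ P * H = H ∧
      H * P = H := by
  set P := hH.cfc fun x => if x = 0 then 0 else 1 with hPdef
  have hP : P.IsHermitian := isHermitian_cfc hH _
  have hPH : P * H = H := by
    rw [hPdef, cfc_mul_self]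
    refine Eq.trans ?_ (eq_cfc_id hH).symm
    congr 1
    ext x
    by_cases h : x = 0 <;> simp [h]
  refine ⟨P, hP, ?_, ?_, hPH, ?_⟩
  · rw [hPdef, cfc_mul_cfc]
    congr 1
    ext x
    split_ifs <;> simp
  · rw [hPdef, trace_cfc, Complex.ofReal_re, hH.rank_eq_card_non_zero_eigs, Fintype.card_subtype,
      ← Finset.sum_boole]
    refine Finset.sum_congr rfl fun k _ => ?_
    by_cases h : hH.eigenvalues k = 0 <;> simp [h]
  · have h := congrArg Matrix.conjTranspose hPH
    rwa [Matrix.conjTranspose_mul, hP.eq, hH.eq] at h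

variable {n : ℕ}

/-- Duality of the trace norm and the operator norm, from the Cauchy–Schwarz inequality in each
vector of an eigenbasis of `Xᴴ X`. -/
lemma norm_trace_mul_le_traceNorm (W X : QMat n) : ‖(W * X).trace‖ ≤ ‖W‖ * traceNorm X := by
  set hX := Matrix.isHermitian_conjTranspose_mul_self X
  rw [← sum_eigenDiag hX, traceNorm, Finset.mul_sum]
  refine (norm_sum_le _ _).trans (Finset.sum_le_sum fun k _ => ?_)
  set U : QMat n := (hX.eigenvectorUnitary : Matrix (Fin n → Fin 2) (Fin n → Fin 2) ℂ) with hU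
  set B : QMat n := W * X * U with hB
  have hUU : Uᴴ * U = 1 := by
    rw [← Matrix.star_eq_conjTranspose]; simp [hU]
  have h1 : eigenDiag hX k (W * X) = ∑ l, Uᴴ k l * B l k := by
    rw [eigenDiag, mul_assoc, ← Matrix.mul_apply]; rfl
  have hsq (M : QMat n) : ∑ l, ‖M l k‖ ^ 2 = ((Mᴴ * M) k k).re := by
    rw [Matrix.mul_apply, Complex.re_sum]
    refine Finset.sum_congr rfl fun l _ => ?_
    rw [Matrix.conjTranspose_apply, ← Complex.normSq_eq_norm_sq, Complex.star_def,
      ← Complex.normSq_eq_conj_mul_self, Complex.ofReal_re]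
  have h2 : ∑ l, ‖U l k‖ ^ 2 = 1 := by rw [hsq, hUU]; simp
  have h3 : ∑ l, ‖B l k‖ ^ 2 ≤ ‖W‖ ^ 2 * hX.eigenvalues k := by
    rw [hsq]
    have h4 := eigenDiag_mono hX k (conj_conjTranspose_mul_self_le W X)
    have h5 : eigenDiag hX k (Xᴴ * X) = hX.eigenvalues k :=
      (congrArg (eigenDiag hX k) (eq_cfc_id hX)).trans (eigenDiag_cfc hX k id)
    have h6 : eigenDiag hX k ((‖W‖ ^ 2) • (Xᴴ * X)) = (‖W‖ ^ 2) • eigenDiag hX k (Xᴴ * X) := by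
      simp only [eigenDiag, mul_smul_comm, smul_mul_assoc, Matrix.smul_apply]
    rw [h6, h5, Complex.smul_re, Complex.ofReal_re, smul_eq_mul] at h4
    refine le_trans (le_of_eq ?_) h4
    rw [eigenDiag, hB, Matrix.conjTranspose_mul, Matrix.conjTranspose_mul]
    simp only [mul_assoc]
    rfl
  have h7 : ‖eigenDiag hX k (W * X)‖ ≤ ∑ l, ‖U l k‖ * ‖B l k‖ := by
    rw [h1]
    refine (norm_sum_le _ _).trans (le_of_eq (Finset.sum_congr rfl fun l _ => ?_))
    rw [norm_mul, Matrix.conjTranspose_apply, norm_star]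
  have h8 := Finset.sum_mul_sq_le_sq_mul_sq Finset.univ (fun l => ‖U l k‖) (fun l => ‖B l k‖)
  rw [h2, one_mul] at h8
  refine h7.trans ((Real.le_sqrt_of_sq_le (h8.trans h3)).trans (le_of_eq ?_))
  rw [Real.sqrt_mul (sq_nonneg _), Real.sqrt_sq (norm_nonneg _)]

/-- The supremum in the duality of the trace norm and the operator norm is attained, at the adjoint
of the partial isometry in the polar decomposition. -/
lemma exists_trace_mul_eq_traceNorm (X : QMat n) :
    ∃ U : QMat n, ‖U‖ ≤ 1 ∧ (U * X).trace.re = traceNorm X := by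
  set hX := Matrix.isHermitian_conjTranspose_mul_self X
  -- `0⁻¹ = 0` makes `G` the pseudo-inverse of the square root of `Xᴴ X`
  set G := hX.cfc fun x => (√x)⁻¹ with hG
  have hGX : G * (Xᴴ * X) = hX.cfc fun x => √x := by
    rw [hG, cfc_mul_self]
    congr 1
    ext x
    by_cases h : √x = 0
    · simp [h]
    · have hx : 0 ≤ x := by
        by_contra hx
        exact h (Real.sqrt_eq_zero_of_nonpos (not_le.1 hx).le)
      rw [inv_mul_eq_iff_eq_mul₀ h, Real.mul_self_sqrt hx]
  refine ⟨G * Xᴴ, ?_, ?_⟩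
  · have h1 : G * Xᴴ * star (G * Xᴴ) = hX.cfc fun x => √x * (√x)⁻¹ := by
      rw [Matrix.star_eq_conjTranspose, Matrix.conjTranspose_mul, (isHermitian_cfc hX _).eq,
        Matrix.conjTranspose_conjTranspose, mul_assoc, ← mul_assoc Xᴴ, ← mul_assoc, hGX,
        cfc_mul_cfc]
    have h2 := CStarRing.norm_self_mul_star (x := G * Xᴴ)
    have h3 : ‖hX.cfc fun x => √x * (√x)⁻¹‖ ≤ 1 := norm_cfc_le_one hX fun x => by
      by_cases h : √x = 0
      · simp [h]
      · rw [mul_inv_cancel₀ h]; simp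
    rw [h1] at h2
    nlinarith [norm_nonneg (G * Xᴴ)]
  · rw [mul_assoc, hGX, trace_cfc, Complex.ofReal_re]
    rfl

lemma traceNorm_le_of_forall {X : QMat n} {C : ℝ}
    (h : ∀ U : QMat n, ‖U‖ ≤ 1 → ‖(U * X).trace‖ ≤ C) : traceNorm X ≤ C := by
  obtain ⟨U, hU, hUX⟩ := exists_trace_mul_eq_traceNorm X
  rw [← hUX]
  exact (Complex.re_le_norm _).trans (h U hU)

lemma traceNorm_nonneg (X : QMat n) : 0 ≤ traceNorm X :=
  Finset.sum_nonneg fun _ _ => Real.sqrt_nonneg _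

lemma traceNorm_add_le (X Y : QMat n) : traceNorm (X + Y) ≤ traceNorm X + traceNorm Y := by
  refine traceNorm_le_of_forall fun U hU => ?_
  rw [mul_add, Matrix.trace_add]
  refine (norm_add_le _ _).trans (add_le_add ?_ ?_)
  · exact (norm_trace_mul_le_traceNorm U X).trans
      (mul_le_of_le_one_left (traceNorm_nonneg X) hU)
  · exact (norm_trace_mul_le_traceNorm U Y).trans
      (mul_le_of_le_one_left (traceNorm_nonneg Y) hU)

lemma frobSq_one : frobSq (1 : QMat n) = 2 ^ n := by
  rw [← trace_conjTranspose_mul_re]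
  simp only [Matrix.conjTranspose_one, mul_one, Matrix.trace_one]
  rw [← Complex.ofReal_natCast, Complex.ofReal_re]
  simp

lemma traceNorm_le_sqrt_mul (X : QMat n) : traceNorm X ≤ √(2 ^ n) * √(frobSq X) := by
  refine traceNorm_le_of_forall fun U hU => (norm_trace_mul_le U X).trans ?_
  have h := sqrt_frobSq_mul_le hU 1
  rw [mul_one, frobSq_one] at h
  gcongr

/-- A tangential matrix has rank at most twice that of `P`, so that its trace norm is controlled by
its Frobenius norm. -/
lemma traceNorm_tangent_le {P Z : QMat n} (hP : P.IsHermitian) (hPP : P * P = P)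
    (hZ : (1 - P) * Z * (1 - P) = 0) : traceNorm Z ≤ 2 * √P.trace.re * √(frobSq Z) := by
  refine traceNorm_le_of_forall fun U hU => ?_
  have e1 : (U * Z).trace = (U * P * Z).trace + (P * U * ((1 - P) * Z)).trace := by
    have e2 : (1 - P) * Z = (1 - P) * Z * P := by
      rw [mul_sub, mul_one, sub_eq_zero] at hZ
      exact hZ
    have e3 : (P * U * ((1 - P) * Z)).trace = (U * ((1 - P) * Z)).trace := by
      rw [mul_assoc, Matrix.trace_mul_comm, mul_assoc, ← e2]
    rw [e3, ← Matrix.trace_add]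
    congr 1
    noncomm_ring
  have h1 := norm_trace_mul_le (U * P) Z
  have h2 := norm_trace_mul_le (P * U) ((1 - P) * Z)
  have h3 : √(frobSq (U * P)) ≤ √P.trace.re := by
    rw [← frobSq_proj hP hPP]; exact sqrt_frobSq_mul_le hU P
  have h4 : √(frobSq (P * U)) ≤ √P.trace.re := by
    rw [← frobSq_proj hP hPP, ← frobSq_conjTranspose, Matrix.conjTranspose_mul, hP.eq]
    exact sqrt_frobSq_mul_le (by rwa [Matrix.l2_opNorm_conjTranspose]) P
  have h5 : √(frobSq ((1 - P) * Z)) ≤ √(frobSq Z) :=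
    Real.sqrt_le_sqrt (frobSq_one_sub_proj_mul_le hP hPP Z)
  rw [e1]
  calc _ ≤ √(frobSq (U * P)) * √(frobSq Z) + √(frobSq (P * U)) * √(frobSq ((1 - P) * Z)) :=
        (norm_add_le _ _).trans (add_le_add h1 h2)
    _ ≤ √P.trace.re * √(frobSq Z) + √P.trace.re * √(frobSq Z) := by gcongr
    _ = _ := by ring

lemma sqrt_frobSq_le_traceNorm (X : QMat n) : √(frobSq X) ≤ traceNorm X := by
  have hX := Matrix.posSemidef_conjTranspose_mul_self X
  refine Real.sqrt_le_iff.2 ⟨traceNorm_nonneg X, ?_⟩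
  have h1 : frobSq X = ∑ i, √(hX.1.eigenvalues i) ^ 2 := by
    rw [← trace_conjTranspose_mul_re, hX.1.trace_eq_sum_eigenvalues, Complex.re_sum]
    refine Finset.sum_congr rfl fun i _ => ?_
    rw [Real.sq_sqrt (hX.eigenvalues_nonneg i)]
    simp
  rw [h1]
  exact Finset.sum_sq_le_sq_sum_of_nonneg fun i _ => Real.sqrt_nonneg _

lemma traceNorm_le_trace {ρ : QMat n} (hρ : ρ.PosSemidef) : traceNorm ρ ≤ ρ.trace.re := by
  refine traceNorm_le_of_forall fun U hU => ?_
  obtain ⟨B, rfl⟩ := CStarAlgebra.nonneg_iff_eq_star_mul_self.mp hρ.nonneg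
  rw [Matrix.star_eq_conjTranspose, trace_conjTranspose_mul_re, ← mul_assoc]
  refine (norm_trace_mul_le _ _).trans ?_
  have h := sqrt_frobSq_mul_le hU Bᴴ
  rw [frobSq_conjTranspose] at h
  calc _ ≤ √(frobSq B) * √(frobSq B) := by gcongr
    _ = _ := Real.mul_self_sqrt (frobSq_nonneg B)

end TraceNorm
end QTomography

/-! ### Random draws -/

namespace QTomography

section Draw

open scoped Matrix.Norms.L2Operator MatrixOrder

variable {n : ℕ} {P : QMat n} {r : ℝ}

/-- The sampled coefficients of all matrices `Z` in the tangent space of the projection `P` carry at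
least half of the mass that they carry on average. -/
def IsWellConditioned {m : ℕ} (P : QMat n) (A : Fin m → PauliLabel n) : Prop :=
  ∀ Z : QMat n, (1 - P) * Z * (1 - P) = 0 →
    m / (2 * 2 ^ n) * frobSq Z ≤ ∑ j, ‖(Z * pauliString (A j)).trace‖ ^ 2

/-- The Chernoff bound for the quadratic forms `Z ↦ |tr (Z (w a)_T)|²`, with `(w a)_T` the
tangential part of `w a`; these vectors live in a space of dimension `d ^ 2` and have squared length at most
`2 r`. -/
lemma drawProb_not_isWellConditioned_le (hP : P.IsHermitian) (hPP : P * P = P)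
    {c : ℝ} (hc : 256 ≤ c) (hn : 1 ≤ n) (hr1 : 1 ≤ r) (hr : P.trace.re ≤ r) {m : ℕ}
    (hm : m ≤ (2 ^ n) ^ 2) (hmc : (m : ℝ) = c * 2 ^ n * r * (Real.log (2 ^ n)) ^ 2) :
    drawProb n m (fun A => ¬ IsWellConditioned P A) ≤ Real.exp (-(1 / 256 * c)) := by
  rw [drawProb_eq_uniformProb]
  set T : PauliLabel n → QMat n := fun a => tangentProj P (pauliString a) with hT
  have hTh (a : PauliLabel n) : (T a).IsHermitian :=
    (isHermitian_pauliString a).sub (isHermitian_conj_one_sub hP (isHermitian_pauliString a))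
  set u : PauliLabel n → (Fin n → Fin 2) × (Fin n → Fin 2) → ℂ := fun a p => T a p.1 p.2 with hu
  have hinner (a : PauliLabel n) (Z : QMat n) :
      star (u a) ⬝ᵥ (fun p => Z p.1 p.2) = (T a * Z).trace := by
    rw [← (hTh a).eq]
    simp only [dotProduct, Matrix.trace, Matrix.diag, Matrix.mul_apply, Fintype.sum_prod_type,
      Matrix.conjTranspose_apply, hu, Pi.star_apply]
    exact Finset.sum_comm
  have htan (a : PauliLabel n) (Z : QMat n) :
      (T a * Z).trace = (tangentProj P Z * pauliString a).trace := by
    have h1 := trace_mul_tangentProj (conj_tangentProj hPP (pauliString a)) Z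
    have h2 := trace_mul_tangentProj (conj_tangentProj hPP Z) (pauliString a)
    rw [hT]
    dsimp only
    rw [← h1, Matrix.trace_mul_comm, h2]
  have hfrob (Z : QMat n) : ∑ p : (Fin n → Fin 2) × (Fin n → Fin 2),
      ‖Z p.1 p.2‖ ^ 2 = frobSq Z := by
    rw [Fintype.sum_prod_type]
    rfl
  have hd : (0 : ℝ) < 2 ^ n := by positivity
  have hcard : (Fintype.card (PauliLabel n) : ℝ) = (2 ^ n) ^ 2 := by
    rw [card_pauliLabel]; push_cast; rfl
  have h := uniformProb_exists_quadratic_lt_le u (β := 2 * r) (μ := 1 / 2 ^ n) (by positivity)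
    (by
      have : (1 : ℝ) / 2 ^ n ≤ 1 := by
        rw [div_le_one hd]; exact one_le_pow₀ one_le_two
      linarith)
    (fun a => by
      have h1 := frobSq_tangentProj_le_two_mul_trace hP hPP (isHermitian_pauliString a)
        (pauliString_mul_self a)
      rw [← hfrob] at h1
      exact h1.trans (by linarith))
    (fun z => by
      have h2 : z = fun p => (Matrix.of fun i j => z (i, j) : QMat n) p.1 p.2 := rfl
      rw [h2, hfrob]
      simp only [hinner, htan]
      rw [sum_norm_trace_sq, hcard]
      have e : ((2 : ℝ) ^ n) ^ 2 * (1 / 2 ^ n) = 2 ^ n := by field_simp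
      rw [e]
      gcongr
      exact frobSq_tangentProj_le hP hPP _)
    (m := m) (by rw [card_pauliLabel]; exact hm)
  refine le_trans (uniformProb_mono fun A hA => ?_) (h.trans ?_)
  · simp only [IsWellConditioned, not_forall, not_le] at hA
    obtain ⟨Z, hZ, hlt⟩ := hA
    refine ⟨fun p => Z p.1 p.2, ?_⟩
    have hZt : tangentProj P Z = Z := by rw [tangentProj, hZ, sub_zero]
    simp only [hinner, htan, hZt]
    rw [hfrob, sum_norm_trace_sq, hcard]
    refine hlt.trans_le (le_of_eq ?_)
    field_simp
    ring
  · set L := Real.log (2 ^ n) with hL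
    have hL2 : 1 / 2 ≤ L := half_le_log_two_pow hn
    have hexpL : Real.exp L = 2 ^ n := Real.exp_log hd
    have e1 : (Fintype.card ((Fin n → Fin 2) × (Fin n → Fin 2)) : ℝ) = Real.exp (2 * L) := by
      rw [two_mul, Real.exp_add, hexpL]
      simp
    have e2 : (m : ℝ) * (1 / 2 ^ n) / (16 * (2 * r)) = c * L ^ 2 / 32 := by
      rw [hmc]
      field_simp
      norm_num
    rw [e1, e2, ← Real.exp_add]
    refine Real.exp_le_exp.2 ?_
    nlinarith [mul_le_mul hL2 hL2 (by norm_num) (by linarith)]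

/-- Markov's inequality for the squared Frobenius norm of `ℛ X`, whose mean is `d² / m` times
that of `X`. -/
lemma drawProb_not_sampling_le {m : ℕ} (hm0 : 0 < m) (hm : m ≤ (2 ^ n) ^ 2) (X : QMat n)
    {lam ε₁ : ℝ} (hlam : 1 ≤ lam) (hX : √(frobSq X) ≤ ε₁) :
    drawProb n m (fun A => ¬ √(frobSq (sampling A X)) ≤ lam * √((2 ^ n) ^ 2 / m) * ε₁) ≤
      1 / lam ^ 2 := by
  rw [drawProb_eq_uniformProb]
  have hm' : (0 : ℝ) < m := by exact_mod_cast hm0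
  have hX0 := frobSq_nonneg X
  set q : ℝ := (2 ^ n) ^ 2 / m with hq
  have hq0 : 0 < q := by positivity
  have hcard : (Fintype.card (PauliLabel n) : ℝ) = (2 ^ n) ^ 2 := by
    rw [card_pauliLabel]; push_cast; rfl
  have hsum : ∑ A : Fin m ↪ PauliLabel n, frobSq (sampling A X) =
      Fintype.card (Fin m ↪ PauliLabel n) * (q * frobSq X) := by
    have h1 (j : Fin m) : ∑ A : Fin m ↪ PauliLabel n, ‖(X * pauliString (A j)).trace‖ ^ 2 =
        Fintype.card (Fin m ↪ PauliLabel n) * (frobSq X / 2 ^ n) := by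
      have h := card_mul_sum_embedding_apply (fun a => ‖(X * pauliString a).trace‖ ^ 2) j
        (by rw [card_pauliLabel]; exact hm)
      rw [sum_norm_trace_sq, hcard] at h
      have hd : ((2 : ℝ) ^ n) ^ 2 ≠ 0 := by positivity
      refine mul_left_cancel₀ hd (h.trans ?_)
      field_simp
    simp only [frobSq_sampling, ← Finset.mul_sum]
    rw [Finset.sum_comm]
    simp only [h1, Finset.sum_const, Finset.card_univ, Fintype.card_fin, nsmul_eq_mul]
    rw [hq]
    field_simp
  rcases hX0.eq_or_lt with h0 | h0
  · -- for `X = 0` the sampled matrix vanishes, and the event is empty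
    have hX1 : X = 0 := by
      ext i j
      have h1 : ∑ i, ∑ j, ‖X i j‖ ^ 2 = 0 := h0.symm
      rw [Fintype.sum_eq_zero_iff_of_nonneg fun i => by positivity] at h1
      have h2 : ∑ j, ‖X i j‖ ^ 2 = 0 := congrFun h1 i
      rw [Fintype.sum_eq_zero_iff_of_nonneg fun i => by positivity] at h2
      simpa using congrFun h2 j
    have h2 := uniformProb_le_div (Ω := Fin m ↪ PauliLabel n)
      (P := fun A => ¬ √(frobSq (sampling A X)) ≤ lam * √q * ε₁) (f := fun _ => 0) (t := 1) (s := 0)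
      one_pos (fun _ => le_rfl) (fun A hA => absurd ?_ hA) (by simp) le_rfl
    · exact h2.trans (by rw [zero_div]; positivity)
    · have : sampling A X = 0 := by simp [hX1, sampling]
      have hε : 0 ≤ ε₁ := (Real.sqrt_nonneg _).trans hX
      have h0 : frobSq (0 : QMat n) = 0 := by simp [frobSq]
      rw [this, h0, Real.sqrt_zero]
      positivity
  · refine (uniformProb_le_div (t := lam ^ 2 * (q * frobSq X)) (s := q * frobSq X)
      (f := fun A : Fin m ↪ PauliLabel n => frobSq (sampling A X))
      (by positivity) (fun _ => frobSq_nonneg _) (fun A hA => ?_) hsum.le (by positivity)).trans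
      (le_of_eq ?_)
    · by_contra! hlt
      refine hA ((Real.sqrt_le_sqrt hlt.le).trans ?_)
      rw [Real.sqrt_mul (sq_nonneg _), Real.sqrt_sq (by linarith), Real.sqrt_mul hq0.le,
        ← mul_assoc]
      gcongr
    · field_simp

end Draw
end QTomography

/-! ### Recovery -/

namespace QTomography

section Recovery

open scoped Matrix.Norms.L2Operator MatrixOrder

variable {n : ℕ} {P : QMat n} {r : ℝ}

/-- `P` and `(1 - P) U (1 - P)` act on orthogonal subspaces. -/
lemma norm_proj_add_conj_le_one (hP : P.IsHermitian) (hPP : P * P = P) {U : QMat n}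
    (hU : ‖U‖ ≤ 1) : ‖P + (1 - P) * U * (1 - P)‖ ≤ 1 := by
  set Q := 1 - P with hQdef
  have hQ : Qᴴ = Q := (Matrix.isHermitian_one.sub hP).eq
  have hQQ : Q * Q = Q := one_sub_mul_self hPP
  have hPQ : P * Q = 0 := mul_one_sub hPP
  have hQP : Q * P = 0 := by rw [hQdef, sub_mul, one_mul, hPP, sub_self]
  set B := Q * U * Q with hB
  have hB1 : ‖B‖ ≤ 1 := (norm_conj_one_sub_le hP hPP U).trans hU
  have hPB : P * B = 0 := by rw [hB, ← mul_assoc, ← mul_assoc, hPQ, zero_mul, zero_mul]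
  have hBP : Bᴴ * P = 0 := by
    have h := congrArg Matrix.conjTranspose hPB
    rwa [Matrix.conjTranspose_mul, hP.eq, Matrix.conjTranspose_zero] at h
  have hBQ : B * Q = B := by rw [hB, mul_assoc, hQQ]
  have h1 : Bᴴ * B ≤ Q := by
    have h := conj_conjTranspose_mul_self_le B Q
    rw [hQ, hQQ] at h
    have e : Q * (Bᴴ * B) * Q = Bᴴ * B := by
      calc Q * (Bᴴ * B) * Q = (Qᴴ * Bᴴ) * (B * Q) := by rw [hQ]; simp only [mul_assoc]
        _ = _ := by rw [← Matrix.conjTranspose_mul, hBQ]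
    rw [e] at h
    refine h.trans ?_
    have hQ0 : 0 ≤ Q := by
      have := Matrix.posSemidef_conjTranspose_mul_self Q
      rw [hQ, hQQ] at this
      exact this.nonneg
    calc (‖B‖ ^ 2) • Q ≤ (1 : ℝ) • Q :=
          smul_le_smul_of_nonneg_right (pow_le_one₀ (norm_nonneg _) hB1) hQ0
      _ = Q := one_smul _ _
  have h2 : star (P + B) * (P + B) = P + Bᴴ * B := by
    rw [Matrix.star_eq_conjTranspose, Matrix.conjTranspose_add, hP.eq, add_mul, mul_add, mul_add,
      hPP, hPB, hBP, add_zero, zero_add]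
  have h3 : star (P + B) * (P + B) ≤ 1 := by
    rw [h2]
    calc P + Bᴴ * B ≤ P + Q := by gcongr
      _ = 1 := by rw [hQdef]; abel
  have h4 := (CStarAlgebra.norm_le_one_iff_of_nonneg _ (star_mul_self_nonneg (P + B))).2 h3
  rw [CStarRing.norm_star_mul_self] at h4
  nlinarith [norm_nonneg (P + B)]

/-- If the trace norm does not increase from `ρ` to `σ`, then the normal part of `σ - ρ` is
controlled by its component along the projection onto the range of `ρ`. -/
lemma trace_re_add_traceNorm_conj_le (hP : P.IsHermitian) (hPP : P * P = P) {ρ σ : QMat n}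
    (hPρ : P * ρ = ρ) (hρ : traceNorm ρ ≤ ρ.trace.re) (hσ : traceNorm σ ≤ traceNorm ρ) :
    (P * (σ - ρ)).trace.re + traceNorm ((1 - P) * (σ - ρ) * (1 - P)) ≤ 0 := by
  obtain ⟨U, hU, hUN⟩ := exists_trace_mul_eq_traceNorm ((1 - P) * (σ - ρ) * (1 - P))
  have hW := norm_proj_add_conj_le_one hP hPP hU
  set W := P + (1 - P) * U * (1 - P) with hWdef
  have h1 : (W * σ).trace.re ≤ traceNorm σ :=
    (Complex.re_le_norm _).trans ((norm_trace_mul_le_traceNorm W σ).trans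
      (mul_le_of_le_one_left (traceNorm_nonneg σ) hW))
  have hWρ : W * ρ = ρ := by
    have h : (1 - P) * ρ = 0 := by rw [sub_mul, one_mul, hPρ, sub_self]
    rw [hWdef, add_mul, hPρ, mul_assoc, h, mul_zero, add_zero]
  have h2 : ((1 - P) * U * (1 - P) * (σ - ρ)).trace =
      (U * ((1 - P) * (σ - ρ) * (1 - P))).trace := by
    rw [mul_assoc, mul_assoc, Matrix.trace_mul_comm]
    simp only [mul_assoc]
  have h3 : (W * σ).trace = ρ.trace + (P * (σ - ρ)).trace +
      (U * ((1 - P) * (σ - ρ) * (1 - P))).trace := by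
    have e : W * σ = W * ρ + (P * (σ - ρ) + (1 - P) * U * (1 - P) * (σ - ρ)) := by
      rw [← add_mul, ← hWdef, ← mul_add, add_sub_cancel]
    rw [e, hWρ, Matrix.trace_add, Matrix.trace_add, h2, add_assoc]
  rw [h3, Complex.add_re, Complex.add_re, hUN] at h1
  linarith

/-- Noisy recovery from a well-conditioned sample that admits a certificate. -/
lemma traceNorm_sub_le_of_hasCertificate (hP : P.IsHermitian) (hPP : P * P = P) {m : ℕ}
    {A : Fin m ↪ PauliLabel n} (hm : m ≤ (2 ^ n) ^ 2) (hr1 : 1 ≤ r)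
    (hr : P.trace.re ≤ r) (hrm : 64 * (r * 2 ^ n) ≤ m) (hA : IsWellConditioned P A)
    (hc : HasCertificate P (r / 2 ^ n) (Set.range A)) {ρ σ : QMat n} (hPρ : P * ρ = ρ)
    (hρ : traceNorm ρ ≤ ρ.trace.re) (hσ : traceNorm σ ≤ traceNorm ρ) {δ : ℝ}
    (hδ : √(frobSq (sampling A (σ - ρ))) ≤ δ) :
    traceNorm (σ - ρ) ≤ 19 * √(r * 2 ^ n) * δ := by
  obtain ⟨V, S, hV, hVr, hS, hS1, hY⟩ := hc
  have hmain := trace_re_add_traceNorm_conj_le hP hPP hPρ hρ hσ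
  -- `Z` and `N` are the tangential and the normal part of the error `Δ`
  set Δ := σ - ρ with hΔ
  set N := (1 - P) * Δ * (1 - P) with hN
  set Z := tangentProj P Δ with hZ
  set d : ℝ := 2 ^ n with hd
  have hd1 : 1 ≤ d := one_le_pow₀ one_le_two
  have hm0 : (0 : ℝ) < m := by nlinarith
  have hmd : (m : ℝ) ≤ d ^ 2 := by rw [hd]; exact_mod_cast hm
  -- `g` is the square root of the fraction of Pauli matrices that are sampled
  set g : ℝ := √m / d with hg
  have hg0 : 0 < g := by positivity
  have hg2 : g ^ 2 = m / d ^ 2 := by rw [hg, div_pow, Real.sq_sqrt hm0.le]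
  have hg1 : g ≤ 1 := by
    have : g ^ 2 ≤ 1 := by rw [hg2]; exact div_le_one_of_le₀ hmd (by positivity)
    nlinarith
  have hδ0 : 0 ≤ δ := (Real.sqrt_nonneg _).trans hδ
  have hrd : r / d ≤ g ^ 2 / 64 := by
    rw [hg2, div_div, div_le_div_iff₀ (by positivity) (by positivity)]
    nlinarith
  have hs1 : 1 ≤ √d := Real.one_le_sqrt.2 hd1
  have hv : √(frobSq V) ≤ g / 8 := by
    refine Real.sqrt_le_iff.2 ⟨by positivity, hVr.trans (hrd.trans (le_of_eq ?_))⟩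
    ring
  have hdecomp : Δ = Z + N := by rw [hZ, tangentProj]; abel
  -- conditioning bounds the tangential part by the sampled part of `Δ` and the normal part
  have hz : √(frobSq Z) ≤ 3 / 2 * (g * δ + √(frobSq N) / g) := by
    have h1 : √(frobSq (sampling A N)) ≤ √(frobSq N) / g ^ 2 := by
      rw [← Real.sqrt_sq (by positivity : 0 ≤ g ^ 2), ← Real.sqrt_div (frobSq_nonneg N),
        frobSq_sampling]
      refine Real.sqrt_le_sqrt ?_
      calc _ ≤ d ^ 3 / m ^ 2 * (d * frobSq N) := by
            gcongr; exact sum_norm_trace_sq_le A N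
        _ = frobSq N / (g ^ 2) ^ 2 := by rw [hg2]; field_simp
    have h2 : √(frobSq Z) ≤ 3 / 2 * g * √(frobSq (sampling A Z)) := by
      refine Real.sqrt_le_iff.2 ⟨by positivity, ?_⟩
      rw [mul_pow, Real.sq_sqrt (frobSq_nonneg _), frobSq_sampling, mul_pow, hg2]
      have h3 := hA Z (conj_tangentProj hPP Δ)
      have h4 : d ^ 3 / m ^ 2 * (m / (2 * d) * frobSq Z) ≤
          d ^ 3 / m ^ 2 * ∑ j, ‖(Z * pauliString (A j)).trace‖ ^ 2 := by gcongr
      calc frobSq Z ≤ 9 / 8 * frobSq Z := by linarith [frobSq_nonneg Z]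
        _ = (3 / 2) ^ 2 * (m / d ^ 2) * (d ^ 3 / m ^ 2 * (m / (2 * d) * frobSq Z)) := by
          field_simp; ring
        _ ≤ _ := by gcongr
    have h5 : √(frobSq (sampling A Z)) ≤ δ + √(frobSq N) / g ^ 2 := by
      have e : sampling A Z = sampling A Δ + -sampling A N := by
        rw [← sub_eq_add_neg, ← sampling_sub, hdecomp, add_sub_cancel_right]
      rw [e]
      refine (sqrt_frobSq_add_le _ _).trans ?_
      rw [frobSq_neg]
      exact add_le_add hδ h1
    calc _ ≤ 3 / 2 * g * (δ + √(frobSq N) / g ^ 2) := h2.trans (by gcongr)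
      _ = _ := by field_simp
  have hN2 := sqrt_frobSq_le_traceNorm N
  -- the certificate only sees the sampled part of `Δ`
  have hYΔ : ‖((P - V + S) * Δ).trace‖ ≤ g ^ 2 * (√d * δ) := by
    have h1 := trace_mul_sampling A Δ hY
    have h2 : ((P - V + S) * Δ).trace = ((g ^ 2 : ℝ) : ℂ) * ((P - V + S) * sampling A Δ).trace := by
      have hm0' : (m : ℂ) ≠ 0 := by exact_mod_cast hm0.ne'
      rw [h1, hg2, hd]
      push_cast
      field_simp
    have h3 : √(frobSq (P - V + S)) ≤ √d := by
      have hP2 : √(frobSq P) ≤ √d / 8 := by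
        rw [frobSq_proj hP hPP]
        refine Real.sqrt_le_iff.2 ⟨by positivity, ?_⟩
        rw [div_pow, Real.sq_sqrt (by positivity)]
        have := mul_le_mul_of_nonneg_right hrd (by positivity : 0 ≤ d)
        rw [div_mul_cancel₀ _ (by positivity : d ≠ 0)] at this
        nlinarith [pow_le_one₀ hg0.le hg1 (n := 2)]
      have hS2 : √(frobSq S) ≤ 1 / 2 * √d := by
        have h := frobSq_mul_le S 1
        rw [mul_one, frobSq_one] at h
        refine Real.sqrt_le_iff.2 ⟨by positivity, h.trans ?_⟩
        rw [mul_pow, Real.sq_sqrt (by positivity)]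
        gcongr
      have hV2 : √(frobSq (-V)) ≤ √d / 8 := by rw [frobSq_neg]; linarith
      have h4 := sqrt_frobSq_add_le (P - V) S
      have h5 := sqrt_frobSq_add_le P (-V)
      rw [← sub_eq_add_neg] at h5
      linarith
    rw [h2, norm_mul, Complex.norm_real, Real.norm_of_nonneg (by positivity)]
    gcongr
    exact (norm_trace_mul_le _ _).trans (by gcongr)
  have hVΔ : ‖(V * Δ).trace‖ ≤ g / 8 * √(frobSq Z) := by
    rw [← trace_mul_tangentProj hV]
    exact (norm_trace_mul_le _ _).trans (by gcongr)
  have hSΔ : ‖(S * Δ).trace‖ ≤ 1 / 2 * traceNorm N := by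
    have e : (S * Δ).trace = (S * N).trace := by
      conv_lhs => rw [← hS]
      rw [mul_assoc, mul_assoc, Matrix.trace_mul_comm, hN]
      simp only [mul_assoc]
    rw [e]
    exact (norm_trace_mul_le_traceNorm S N).trans
      (mul_le_mul_of_nonneg_right hS1 (traceNorm_nonneg N))
  have hNle : traceNorm N ≤ 4 * √d * g ^ 2 * δ := by
    have e : (P * Δ).trace = ((P - V + S) * Δ).trace + (V * Δ).trace - (S * Δ).trace := by
      rw [← Matrix.trace_add, ← Matrix.trace_sub, ← add_mul, ← sub_mul]
      congr 2
      abel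
    rw [e, Complex.sub_re, Complex.add_re] at hmain
    have h1 := (abs_le.1 ((Complex.abs_re_le_norm _).trans hYΔ)).1
    have h2 := (abs_le.1 ((Complex.abs_re_le_norm _).trans hVΔ)).1
    have h3 := (abs_le.1 ((Complex.abs_re_le_norm _).trans hSΔ)).2
    have h4 : g / 8 * √(frobSq Z) ≤ 3 / 16 * (g ^ 2 * δ + traceNorm N) := by
      calc _ ≤ g / 8 * (3 / 2 * (g * δ + traceNorm N / g)) := by
            gcongr
            exact hz.trans (by gcongr)
        _ = _ := by field_simp; ring
    have h5 : g ^ 2 * δ ≤ g ^ 2 * (√d * δ) := by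
      gcongr
      exact le_mul_of_one_le_left hδ0 hs1
    have h6 : 0 ≤ g ^ 2 * (√d * δ) := by positivity
    linarith
  have hZle : √(frobSq Z) ≤ 15 / 2 * √d * δ := by
    have h1 : √(frobSq N) / g ≤ 4 * √d * g * δ := by
      rw [div_le_iff₀ hg0]
      refine hN2.trans (hNle.trans (le_of_eq ?_))
      ring
    have h2 : g * δ ≤ √d * δ := by gcongr; linarith
    have h3 : 4 * √d * g * δ ≤ 4 * √d * 1 * δ := by gcongr
    linarith
  have hP0 := Real.sqrt_le_sqrt hr
  have hsr : 1 ≤ √r := Real.one_le_sqrt.2 hr1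
  have hZt := traceNorm_tangent_le hP hPP (conj_tangentProj hPP Δ)
  rw [← hZ] at hZt
  rw [Real.sqrt_mul (by linarith)]
  have hN' : traceNorm N ≤ 4 * (√r * √d * δ) := by
    calc _ ≤ 4 * √d * 1 ^ 2 * δ := hNle.trans (by gcongr)
      _ = 4 * (1 * √d * δ) := by ring
      _ ≤ _ := by gcongr
  have hZ' : traceNorm Z ≤ 15 * (√r * √d * δ) := by
    calc _ ≤ 2 * √r * (15 / 2 * √d * δ) := hZt.trans (by gcongr)
      _ = _ := by ring
  calc traceNorm Δ = traceNorm (Z + N) := by rw [← hdecomp]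
    _ ≤ traceNorm Z + traceNorm N := traceNorm_add_le Z N
    _ ≤ _ := by linarith

lemma frobeniusNorm_eq (X : QMat n) : frobeniusNorm X = √(frobSq X) := rfl

/-- Error bound for the solutions of the noisy program, on the event that the sampled part of
`ρt - ρ` is small. -/
lemma traceNorm_sub_le_of_isSolution {m : ℕ} {A : Fin m ↪ PauliLabel n} (hP : P.IsHermitian)
    (hPP : P * P = P) (hm : m ≤ (2 ^ n) ^ 2) (hr1 : 1 ≤ r)
    (hr : P.trace.re ≤ r) (hrm : 64 * (r * 2 ^ n) ≤ m) (hA : IsWellConditioned P A)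
    (hc : HasCertificate P (r / 2 ^ n) (Set.range A)) {ρ ρt ω σ : QMat n} (hPρ : P * ρ = ρ)
    (hρ : traceNorm ρ ≤ ρ.trace.re) {S : Set (QMat n)} (hS : ρ ∈ S) {ε ε' ε₂ : ℝ}
    (hε : ε' + ε₂ ≤ ε) (hρt : √(frobSq (ρt - ρ)) ≤ ε)
    (hε' : √(frobSq (sampling A (ρt - ρ))) ≤ ε')
    (hω : frobeniusNorm (sampling A ω - sampling A ρt) ≤ ε₂) (hσ : IsSolution S A ω ε σ) :
    traceNorm (σ - ρt) ≤ 39 * (ε * √(r * 2 ^ n)) := by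
  obtain ⟨⟨-, hσf⟩, hσmin⟩ := hσ
  have hρf : frobeniusNorm (sampling A ω - sampling A ρ) ≤ ε := by
    rw [sampling_sub] at hε'
    have h := sqrt_frobSq_add_le (sampling A ω - sampling A ρt) (sampling A ρt - sampling A ρ)
    rw [sub_add_sub_cancel] at h
    rw [frobeniusNorm_eq] at hω ⊢
    linarith
  have hρf' : IsFeasible A ω ε ρ := by
    rw [IsFeasible, frobeniusNorm_eq, ← frobSq_neg, neg_sub]
    exact hρf
  have hδ : √(frobSq (sampling A (σ - ρ))) ≤ 2 * ε := by
    rw [sampling_sub]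
    have h := sqrt_frobSq_add_le (sampling A σ - sampling A ω) (sampling A ω - sampling A ρ)
    rw [sub_add_sub_cancel] at h
    rw [IsFeasible, frobeniusNorm_eq] at hσf
    rw [frobeniusNorm_eq] at hρf
    linarith
  have h1 := traceNorm_sub_le_of_hasCertificate hP hPP hm hr1 hr hrm hA hc hPρ hρ
    (hσmin ρ hS hρf') hδ
  have h2 : traceNorm (ρ - ρt) ≤ √(r * 2 ^ n) * ε := by
    refine (traceNorm_le_sqrt_mul _).trans ?_
    rw [← frobSq_neg, neg_sub]
    gcongr
    exact le_mul_of_one_le_left (by positivity) hr1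
  have h3 := traceNorm_add_le (σ - ρ) (ρ - ρt)
  rw [sub_add_sub_cancel] at h3
  linarith

lemma drawProb_le_add {m : ℕ} {P Q R : (Fin m ↪ PauliLabel n) → Prop}
    (h : ∀ A, P A → Q A ∨ R A) : drawProb n m P ≤ drawProb n m Q + drawProb n m R :=
  uniformProb_le_add h

/-- The probability of failure when the oversampling factor `c` is at least `256`. -/
lemma drawProb_not_recovery_le {r m : ℕ} {c : ℝ} (hc : 256 ≤ c) (hn : 1 ≤ n) (hr1 : 1 ≤ r)
    (hm : m ≤ (2 ^ n) ^ 2) (hmc : (m : ℝ) = c * 2 ^ n * r * (Real.log (2 ^ n)) ^ 2)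
    {ρt ρ : QMat n} (hρ : IsState ρ) (hrank : ρ.rank ≤ r) {ε₁ ε₂ lam ε : ℝ}
    (hε₁ : frobeniusNorm (ρt - ρ) ≤ ε₁) (hε₂ : 0 ≤ ε₂) (hlam : 1 ≤ lam)
    (hε : lam * √((2 ^ n) ^ 2 / m) * ε₁ + ε₂ ≤ ε) {S : Set (QMat n)} (hρS : ρ ∈ S) :
    drawProb n m (fun A => ¬ ∀ ω σ : QMat n,
        frobeniusNorm (sampling A ω - sampling A ρt) ≤ ε₂ → IsSolution S A ω ε σ →
        traceNorm (σ - ρt) ≤ 39 * (ε * √(r * 2 ^ n))) ≤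
      1 / lam ^ 2 + 4 * Real.exp (-(1 / 256 * c)) := by
  have hL := half_le_log_two_pow hn
  have hr1' : (1 : ℝ) ≤ r := by exact_mod_cast hr1
  have hd1 : (1 : ℝ) ≤ 2 ^ n := one_le_pow₀ one_le_two
  have hrm : 64 * ((r : ℝ) * 2 ^ n) ≤ m := by
    rw [hmc]
    have h1 : 64 ≤ c * Real.log (2 ^ n) ^ 2 := by nlinarith
    calc 64 * ((r : ℝ) * 2 ^ n) ≤ c * Real.log (2 ^ n) ^ 2 * (r * 2 ^ n) := by gcongr
      _ = _ := by ring
  have hm0 : 0 < m := by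
    have : (0 : ℝ) < m := by nlinarith
    exact_mod_cast this
  obtain ⟨P, hP, hPP, hPr, hPρ, -⟩ := exists_range_projection hρ.1.1
  have hPr' : P.trace.re ≤ r := by rw [hPr]; exact_mod_cast hrank
  have hε₁0 : 0 ≤ ε₁ := (Real.sqrt_nonneg _).trans hε₁
  have hρt : √(frobSq (ρt - ρ)) ≤ ε := by
    have hm' : (m : ℝ) ≤ (2 ^ n) ^ 2 := by exact_mod_cast hm
    have h1 : 1 ≤ √((2 ^ n) ^ 2 / m) :=
      Real.one_le_sqrt.2 ((one_le_div (by exact_mod_cast hm0)).2 hm')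
    have h2 : ε₁ ≤ lam * √((2 ^ n) ^ 2 / m) * ε₁ :=
      le_mul_of_one_le_left hε₁0 (one_le_mul_of_one_le_of_one_le hlam h1)
    rw [frobeniusNorm_eq] at hε₁
    linarith
  have hA := drawProb_not_sampling_le hm0 hm (ρt - ρ) hlam hε₁
  have hB := drawProb_not_isWellConditioned_le hP hPP hc hn hr1' hPr' hm hmc
  have hC := drawProb_not_hasCertificate_le hP hPP hc hn hr1' hPr' hm hmc
  have hBC := drawProb_le_add fun (A : Fin m ↪ PauliLabel n)
    (h : ¬ IsWellConditioned P A ∨ ¬ HasCertificate P (r / 2 ^ n) (Set.range A)) => h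
  refine (drawProb_le_add
    (Q := fun A => ¬ √(frobSq (sampling A (ρt - ρ))) ≤ lam * √((2 ^ n) ^ 2 / m) * ε₁)
    fun A hAll => ?_).trans ((add_le_add hA (hBC.trans (add_le_add hB hC))).trans (le_of_eq ?_))
  · by_contra h
    rw [not_or, not_or, not_not, not_not, not_not] at h
    obtain ⟨h1, h2, h3⟩ := h
    exact hAll fun ω σ hω hσ => traceNorm_sub_le_of_isSolution hP hPP hm hr1' hPr' hrm h2 h3 hPρ
      (traceNorm_le_trace hρ.1) hρS hε hρt h1 hω hσ
  · ring

end Recovery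
end QTomography

open QTomography in
theorem mainTheorem2 :
    ∃ K B b : ℝ, 0 < K ∧ 0 < B ∧ 0 < b ∧
      ∀ (n r m : ℕ) (c : ℝ), 1 ≤ n → 1 ≤ r → 0 < c →
        m ≤ (2 ^ n) ^ 2 →
        (m : ℝ) = c * 2 ^ n * r * (Real.log (2 ^ n)) ^ 2 →
        ∀ (ρt ρ : QTomography.QMat n),
          QTomography.IsState ρt → QTomography.IsState ρ → ρ.rank ≤ r →
        ∀ (ε₁ ε₂ lam ε : ℝ),
          QTomography.frobeniusNorm (ρt - ρ) ≤ ε₁ → 0 ≤ ε₂ → 1 ≤ lam →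
          lam * Real.sqrt ((2 ^ n) ^ 2 / m) * ε₁ + ε₂ ≤ ε →
        ∀ S : Set (QTomography.QMat n),
          (S = Set.univ ∨ S = {σ | σ.IsHermitian}) →
          QTomography.drawProb n m (fun A => ¬ ∀ ω σ : QTomography.QMat n,
              QTomography.frobeniusNorm
                (QTomography.sampling A ω - QTomography.sampling A ρt) ≤ ε₂ →
              QTomography.IsSolution S A ω ε σ →
              QTomography.traceNorm (σ - ρt) ≤ K * (ε * Real.sqrt (r * 2 ^ n)))
            ≤ 1 / lam ^ 2 + B * Real.exp (-(b * c)) := by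
  refine ⟨39, 4, 1 / 256, by norm_num, by norm_num, by norm_num, ?_⟩
  intro n r m c hn hr1 hc0 hm hmc ρt ρ _ hρ hrank ε₁ ε₂ lam ε hε₁ hε₂ hlam hε S hS
  rcases lt_or_ge c 256 with hc | hc
  · -- the asserted bound on the probability exceeds `1`
    rw [drawProb_eq_uniformProb]
    refine (uniformProb_le_one _).trans ?_
    have h1 : Real.exp (-1) ≤ Real.exp (-(1 / 256 * c)) := Real.exp_le_exp.2 (by linarith)
    have h2 := Real.exp_neg_one_gt_d9
    have h3 : 0 ≤ 1 / lam ^ 2 := by positivity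
    linarith
  · have hρS : ρ ∈ S := by
      rcases hS with rfl | rfl
      · exact Set.mem_univ _
      · exact hρ.1.1
    exact drawProb_not_recovery_le hc hn hr1 hm hmc hρ hrank hε₁ hε₂ hlam hε hρS
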